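/- **Setting.** Every relation name $R$ has an arity $n\ge 1$, and its first $k$ positions ($k \le n$) form its primary key. Atoms $R(s_1,\dots,s_n)$ are built from variables and constants, the constants forming an infinite set. A fact is an atom without variables, and a database is a finite set of facts. Two facts are key-equal if they have the same relation name and agree on the primary-key positions. A database is consistent if no two distinct facts in it are key-equal, and a repair of a database is an inclusion-maximal consistent subset of it. For an atom $F$, $\mathrm{key}(F)$ is the set of variables at its primary-key positions, $\mathrm{vars}(F)$ the set of all its variables, and $\mathrm{notkey}(F)=\mathrm{vars}(F)\setminus\mathrm{key}(F)$. A conjunctive query $q(\vec z)$ is a finite set of atoms (its body) some of whose variables, $\vec z=\mathrm{free}(q)$, are free, the others being bound (existentially quantified). It is self-join-free if distinct atoms have distinct relation names. A tuple $\vec c$ is a consistent answer to $q$ on $db$ if $r\models q(\vec c)$ for every repair $r$ of $db$. A consistent first-order rewriting of $q$ is a first-order formula $\varphi(\vec z)$ such that, for all $db$ and $\vec c$, $db\models\varphi(\vec c)$ if and only if $\vec c$ is a consistent answer to $q$ on $db$. **Parsimonious counting.** Let $q(\vec z)$ be a self-join-free conjunctive query with bound variables $\vec w$, and let $q^*(\vec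 z,\vec w)$ be the full query with the same body. On a database $r$, the counting query returns $(\vec c,i)$ if $i\ge 1$ and $i$ is the number of tuples $\vec d$ with $r\models q^*(\vec c,\vec d)$. Its range semantics returns $(\vec c,[m,n])$ on $db$ if on every repair of $db$ the counting query returns $(\vec c,i)$ for some $i$ with $m\le i\le n$, and both $(\vec c,m)$ and $(\vec c,n)$ are returned on some repair. The query $q$ admits parsimonious counting if there is a (possibly empty) tuple $\vec x$ of distinct bound variables such that, for the query $q'(\vec z,\vec x)$ obtained from $q$ by making $\vec x$ free, (A) $q$ has a consistent first-order rewriting; (B) $q'$ has a consistent first-order rewriting; (C) for all $db$, $\vec c$, $m$, $n$, the range semantics returns $(\vec c,[m,n])$ on $db$ if and only if $m\ge 1$, $m$ is the number of tuples $\vec d$ such that $(\vec c,\vec d)$ is a consistent answer to $q'$ on $db$, and $n$ is the number of tuples $\vec d$ such that $db\models q'(\vec c,\vec d)$. **The class $\mathsf{Cparsimony}$.** Let $\mathcal F(q)$ consist of the functional dependencies $\emptyset\to\mathrm{free}(q)$ and $\mathrm{key}(F)\to\mathrm{vars}(F)$ for every atom $F$ of $q$. Let $F^{+}$ be the set of variables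 $y$ of $q$ with $y\in\mathrm{free}(q)$ or $\mathcal F(q\setminus\{F\})\models\mathrm{key}(F)\to y$. An atom $F$ attacks a variable $x$ if there is a sequence $x_1,\dots,x_n$ ($n\ge1$) of bound variables, none of them in $F^+$, with $x_1\in\mathrm{notkey}(F)$ and $x_n=x$, in which any two adjacent variables occur together in some atom of $q$. The attack graph has the atoms of $q$ as vertices and an edge (an attack) from $F$ to $G$ if $F\ne G$ and $F$ attacks some variable of $G$. This attack is strong if $\mathcal F(q)\not\models\mathrm{key}(F)\to\mathrm{key}(G)$. A sequential proof of $\mathcal F(q)\models\emptyset\to v$ is a sequence $F_1,\dots,F_n$ ($n\ge 0$) of atoms of $q$ such that $\mathrm{key}(F_i)\subseteq\mathrm{free}(q)\cup\bigcup_{j<i}\mathrm{vars}(F_j)$ for all $i$ and $v\in\mathrm{free}(q)\cup\bigcup_{j}\mathrm{vars}(F_j)$. A variable $v$ is frozen if it has such a proof in which no atom attacks $v$. The query graph has the bound variables as vertices, two distinct ones being adjacent if they occur together in some atom. A tuple $\vec x$ of bound variables is an id-set for $q$ if 1. (source) every weakly connected component of the attack graph contains an atom $R$ that no atom attacks and that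 satisfies $\mathcal F(q)\models\vec x\to\mathrm{key}(R)$; and 2. (separation) for every atom $R$ of $q$, every path (possibly of length zero) in the query graph between a variable of $\mathrm{notkey}(R)$ and a variable of $\vec x$ uses a variable that is in $\mathrm{key}(R)$ or frozen. The query $q$ is in $\mathsf{Cparsimony}$ if its attack graph is acyclic and contains no strong attack, and $q$ has an id-set. **Theorem.** A self-join-free conjunctive query $q$ admits parsimonious counting if and only if $q$ is in $\mathsf{Cparsimony}$. -/

import Mathlib

/-- A relational schema: every relation name `R` has a positive arity `arity R`, and its primary-key
positions are the first `keyLen R` positions. -/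
structure Schema where
  Rel : Type*
  arity : Rel → ℕ
  keyLen : Rel → ℕ
  arity_pos : ∀ R, 0 < arity R
  keyLen_le : ∀ R, keyLen R ≤ arity R

/-- An atom `R(s₁, …, sₙ)` whose entries are taken from `T`. -/
structure RelAtom (σ : Schema) (T : Type*) where
  rel : σ.Rel
  args : Fin (σ.arity rel) → T

/-- Terms: variables (from `V`) or constants (from `C`). -/
abbrev QTerm (V C : Type*) := V ⊕ C

/-- An atom over variables from `V` and constants from `C`. -/
abbrev QAtom (σ : Schema) (V C : Type*) := RelAtom σ (QTerm V C)

/-- A fact is an atom in which no variable occurs. -/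
abbrev DBFact (σ : Schema) (C : Type*) := RelAtom σ C

/-- Two atoms are key-equal if they have the same relation name and agree on all primary-key
positions. -/
def RelAtom.KeyEqual {σ : Schema} {T : Type*} (A B : RelAtom σ T) : Prop :=
  ∃ h : A.rel = B.rel, ∀ i : Fin (σ.arity A.rel), (i : ℕ) < σ.keyLen A.rel →
    A.args i = B.args (Fin.cast (congrArg σ.arity h) i)

/-- A database instance: a finite set of facts. -/
abbrev Database (σ : Schema) (C : Type*) := Finset (DBFact σ C)

/-- No two distinct facts are key-equal. -/
def Database.Consistent {σ : Schema} {C : Type*} (db : Database σ C) : Prop :=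
  ∀ A ∈ db, ∀ B ∈ db, A.KeyEqual B → A = B

/-- `r` is a repair of `db`: an inclusion-maximal consistent subset. -/
def Database.IsRepair {σ : Schema} {C : Type*} (db r : Database σ C) : Prop :=
  Maximal (fun s : Database σ C => s ⊆ db ∧ s.Consistent) r

namespace RelAtom

variable {σ : Schema} {V C : Type*}

/-- The variables at primary-key positions. -/
def key (F : QAtom σ V C) : Set V :=
  {v | ∃ i : Fin (σ.arity F.rel), (i : ℕ) < σ.keyLen F.rel ∧ F.args i = Sum.inl v}

/-- All variables of the atom. -/
def vars (F : QAtom σ V C) : Set V :=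
  {v | ∃ i : Fin (σ.arity F.rel), F.args i = Sum.inl v}

/-- The variables that occur in the atom, but not at a primary-key position. -/
def notKey (F : QAtom σ V C) : Set V := F.vars \ F.key

/-- The fact `θ(F)` for a valuation `θ`. -/
def inst (θ : V → C) (F : QAtom σ V C) : DBFact σ C :=
  ⟨F.rel, fun i => Sum.elim θ id (F.args i)⟩

end RelAtom

/-- A conjunctive query, given by the finite set of its atoms and the set of its free variables. -/
structure ConjQuery (σ : Schema) (V C : Type*) where
  body : Set (QAtom σ V C)
  finite_body : body.Finite
  free : Set V
  free_subset : free ⊆ {v | ∃ F ∈ body, v ∈ F.vars}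

/-- A functional dependency `lhs → rhs` over the attributes `V`. -/
structure FunDep (V : Type*) where
  lhs : Set V
  rhs : Set V

/-- A relation (a set of tuples over the attributes `V`) satisfies a functional dependency. -/
def FunDep.Holds {V D : Type*} (I : Set (V → D)) (f : FunDep V) : Prop :=
  ∀ s ∈ I, ∀ t ∈ I, (∀ v ∈ f.lhs, s v = t v) → ∀ v ∈ f.rhs, s v = t v

/-- Logical implication `S ⊨ Z → W` of functional dependencies: every relation that satisfies `S`
satisfies `Z → W`. -/
def FDImplies {V : Type*} (S : Set (FunDep V)) (Z W : Set V) : Prop :=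
  ∀ I : Set (V → ℕ), (∀ f ∈ S, f.Holds I) → (FunDep.mk Z W).Holds I

namespace ConjQuery

variable {σ : Schema} {V C : Type*}

/-- Distinct atoms have distinct relation names. -/
def SelfJoinFree (q : ConjQuery σ V C) : Prop :=
  ∀ F ∈ q.body, ∀ G ∈ q.body, F.rel = G.rel → F = G

/-- The variables that occur in the query. -/
def vars (q : ConjQuery σ V C) : Set V := {v | ∃ F ∈ q.body, v ∈ F.vars}

/-- The bound (existentially quantified) variables. -/
def bound (q : ConjQuery σ V C) : Set V := q.vars \ q.free

/-! ### Semantics -/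

/-- `db ⊨ q(c)`. A tuple for the free variables is a function on the set of free variables. -/
def Sat (q : ConjQuery σ V C) (db : Database σ C) (c : q.free → C) : Prop :=
  ∃ θ : V → C, (∀ v : q.free, θ v = c v) ∧ ∀ F ∈ q.body, F.inst θ ∈ db

/-- `c` is a consistent answer: `r ⊨ q(c)` for every repair `r` of `db`. -/
def CertainSat (q : ConjQuery σ V C) (db : Database σ C) (c : q.free → C) : Prop :=
  ∀ r, db.IsRepair r → q.Sat r c

/-- The query obtained from `q` by making the bound variables in `x` free. -/
def makeFree (q : ConjQuery σ V C) (x : Set V) (hx : x ⊆ q.bound) : ConjQuery σ V C where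
  body := q.body
  finite_body := q.finite_body
  free := q.free ∪ x
  free_subset := Set.union_subset q.free_subset fun _ hv => (hx hv).1

open Classical in
/-- The concatenation of a tuple `c` for the free variables of `q` and a tuple `d` for `x`. -/
noncomputable def glue (q : ConjQuery σ V C) (x : Set V) (hx : x ⊆ q.bound)
    (c : q.free → C) (d : x → C) : (q.makeFree x hx).free → C :=
  fun v => if h : (v : V) ∈ q.free then c ⟨v, h⟩ else d ⟨v, v.2.resolve_left h⟩

/-- The counting query, on the database `r`, returns the tuple `(c, i)`: the number `i` is positive
and is the number of tuples `d` for the bound variables of `q` such that `(c, d)` is an answer to the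
full query with the same body as `q`. -/
def CountReturns (q : ConjQuery σ V C) (r : Database σ C) (c : q.free → C) (i : ℕ) : Prop :=
  1 ≤ i ∧ i = Set.ncard {d : q.bound → C |
    (q.makeFree q.bound subset_rfl).Sat r (q.glue q.bound subset_rfl c d)}

/-- The range semantics of the counting query returns `(c, [m, n])` on `db`: on every repair the
counting query returns some `(c, i)` with `m ≤ i ≤ n`, and both bounds are attained. -/
def RangeReturns (q : ConjQuery σ V C) (db : Database σ C) (c : q.free → C) (m n : ℕ) : Prop :=
  (∀ r, db.IsRepair r → ∃ i, q.CountReturns r c i ∧ m ≤ i ∧ i ≤ n) ∧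
  (∃ r, db.IsRepair r ∧ q.CountReturns r c m) ∧
  (∃ r, db.IsRepair r ∧ q.CountReturns r c n)

end ConjQuery

/-! ### First-order rewritings -/

/-- The relational first-order language of a schema. -/
def Schema.language.{u} (σ : Schema.{u}) : FirstOrder.Language.{0, u} where
  Functions := fun _ => Empty
  Relations := fun n => {R : σ.Rel // σ.arity R = n}

/-- A database as a first-order structure on the set `C` of constants. -/
@[reducible] def Database.toStructure {σ : Schema} {C : Type*} (db : Database σ C) :
    σ.language.Structure C where
  funMap := fun f _ => nomatch f
  RelMap := fun R a => (⟨R.1, fun i => a (Fin.cast R.2 i)⟩ : DBFact σ C) ∈ db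

namespace ConjQuery

variable {σ : Schema} {V C : Type*}

open FirstOrder in
/-- `φ` is a consistent first-order rewriting of `q`: a first-order formula over the schema, with
constants, whose free variables are those of `q`, and that defines the consistent answers to `q` on
every database. -/
def IsConsistentRewriting (q : ConjQuery σ V C) (φ : (σ.language[[C]]).Formula q.free) : Prop :=
  ∀ (db : Database σ C) (c : q.free → C),
    letI : σ.language.Structure C := db.toStructure
    φ.Realize c ↔ q.CertainSat db c

open FirstOrder in
/-- `q` has a consistent first-order rewriting. -/
def HasConsistentRewriting (q : ConjQuery σ V C) : Prop :=
  ∃ φ : (σ.language[[C]]).Formula q.free, q.IsConsistentRewriting φ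

/-! ### Parsimonious counting -/

/-- `q` admits parsimonious counting on the set `x` of bound variables: `q`, and the query `q'`
obtained from `q` by making `x` free, have consistent first-order rewritings, and the lower and upper
bounds of the count are the numbers of consistent answers and of answers to `q'`, respectively. -/
def AdmitsParsimoniousCountingOn (q : ConjQuery σ V C) (x : Set V) (hx : x ⊆ q.bound) : Prop :=
  q.HasConsistentRewriting ∧
  (q.makeFree x hx).HasConsistentRewriting ∧
  ∀ (db : Database σ C) (c : q.free → C) (m n : ℕ),
    q.RangeReturns db c m n ↔
      1 ≤ m ∧
      m = Set.ncard {d : x → C | (q.makeFree x hx).CertainSat db (q.glue x hx c d)} ∧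
      n = Set.ncard {d : x → C | (q.makeFree x hx).Sat db (q.glue x hx c d)}

/-- `q` admits parsimonious counting (on some set of bound variables). -/
def AdmitsParsimoniousCounting (q : ConjQuery σ V C) : Prop :=
  ∃ (x : Set V) (hx : x ⊆ q.bound), q.AdmitsParsimoniousCountingOn x hx

/-! ### Attack graphs -/

/-- The query obtained from `q` by removing the atom `F`; variables that remain keep their status
(free or bound). -/
def remove (q : ConjQuery σ V C) (F : QAtom σ V C) : ConjQuery σ V C where
  body := q.body \ {F}
  finite_body := q.finite_body.subset Set.sdiff_subset
  free := q.free ∩ {v | ∃ G ∈ q.body \ {F}, v ∈ G.vars}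
  free_subset := Set.inter_subset_right

/-- The functional dependencies `∅ → free(q)`, and `key(F) → vars(F)` for every atom `F` of `q`. -/
def fdSet (q : ConjQuery σ V C) : Set (FunDep V) :=
  insert ⟨∅, q.free⟩ {f | ∃ F ∈ q.body, f = ⟨F.key, F.vars⟩}

/-- The variables `y` of `q` that are free or satisfy `fdSet (q \ {F}) ⊨ key(F) → y`. -/
def keyClosure (q : ConjQuery σ V C) (F : QAtom σ V C) : Set V :=
  {y | y ∈ q.vars ∧ (y ∈ q.free ∨ FDImplies (q.remove F).fdSet F.key {y})}

/-- Two variables occur together in some atom of `q`. -/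
def OccurTogether (q : ConjQuery σ V C) (u v : V) : Prop :=
  ∃ F ∈ q.body, u ∈ F.vars ∧ v ∈ F.vars

/-- The atom `F` attacks the variable `x` : there is a witness, that is, a sequence `u :: l` of bound
variables outside the key closure of `F` that starts in `notKey F`, ends in `x`, and in which adjacent
variables occur together in some atom. -/
def AttacksVar (q : ConjQuery σ V C) (F : QAtom σ V C) (x : V) : Prop :=
  ∃ (u : V) (l : List V),
    List.IsChain q.OccurTogether (u :: l) ∧
    u ∈ F.notKey ∧
    (u :: l).getLast (List.cons_ne_nil u l) = x ∧
    ∀ v ∈ u :: l, v ∈ q.bound ∧ v ∉ q.keyClosure F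

/-- The edge relation of the attack graph, whose vertices are the atoms of `q`. -/
def Attacks (q : ConjQuery σ V C) (F G : q.body) : Prop :=
  F ≠ G ∧ ∃ x ∈ (G : QAtom σ V C).vars, q.AttacksVar F x

/-- The attack graph is acyclic. -/
def AttackAcyclic (q : ConjQuery σ V C) : Prop :=
  ∀ F : q.body, ¬ Relation.TransGen q.Attacks F F

/-- There is a strong attack from `F` to `G`: an attack that is not weak. -/
def StrongAttacks (q : ConjQuery σ V C) (F G : q.body) : Prop :=
  q.Attacks F G ∧ ¬ FDImplies q.fdSet (F : QAtom σ V C).key (G : QAtom σ V C).key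

/-- No atom attacks `F`. -/
def Unattacked (q : ConjQuery σ V C) (F : q.body) : Prop :=
  ∀ G : q.body, ¬ q.Attacks G F

/-- The undirected graph underlying the attack graph; its connected components are the components
(maximal weakly connected subgraphs) of the attack graph. -/
def weakAttackGraph (q : ConjQuery σ V C) : SimpleGraph q.body :=
  SimpleGraph.fromRel q.Attacks

/-! ### The class Cparsimony -/

/-- The variables available after the atoms of `l` have been used, starting from `Z`. -/
def derived (q : ConjQuery σ V C) (Z : Set V) (l : List (QAtom σ V C)) : Set V :=
  q.free ∪ Z ∪ {v | ∃ F ∈ l, v ∈ F.vars}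

/-- `l` is a sequence of atoms of `q` in which every key is contained in the union of the free
variables, `Z`, and the variables of the preceding atoms. It is a sequential proof of `Z → w` for
every `w` in `q.derived Z l`. -/
def IsSequentialProof (q : ConjQuery σ V C) (Z : Set V) (l : List (QAtom σ V C)) : Prop :=
  (∀ F ∈ l, F ∈ q.body) ∧
  ∀ i (hi : i < l.length), (l[i]).key ⊆ q.derived Z (l.take i)

/-- The frozen variables `v`: there is a sequential proof of `∅ → v` none of whose atoms
attacks `v`. -/
def frozen (q : ConjQuery σ V C) : Set V :=
  {v | v ∈ q.vars ∧ ∃ l, q.IsSequentialProof ∅ l ∧ v ∈ q.derived ∅ l ∧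
    ∀ F ∈ l, ¬ q.AttacksVar F v}

/-- The query graph: vertices are the bound variables; distinct variables are adjacent if they occur
together in some atom. -/
def queryGraph (q : ConjQuery σ V C) : SimpleGraph q.bound where
  Adj u v := u ≠ v ∧ q.OccurTogether u v
  symm := ⟨fun _ _ h => ⟨h.1.symm, h.2.imp fun _ hF => ⟨hF.1, hF.2.2, hF.2.1⟩⟩⟩
  loopless := ⟨fun _ h => h.1 rfl⟩

/-- Source condition: every component of the attack graph contains an unattacked atom whose key is
determined by `x`. -/
def SourceCondition (q : ConjQuery σ V C) (x : Set V) : Prop :=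
  ∀ M : q.weakAttackGraph.ConnectedComponent,
    ∃ R ∈ M.supp, q.Unattacked R ∧ FDImplies q.fdSet x (R : QAtom σ V C).key

/-- Separation condition: for every atom `R`, every path of the query graph between a variable of
`notKey R` and a variable of `x` uses a variable that is frozen or in `key R`. -/
def SeparationCondition (q : ConjQuery σ V C) (x : Set V) : Prop :=
  ∀ R ∈ q.body, ∀ u v : q.bound, (u : V) ∈ R.notKey → (v : V) ∈ x →
    ∀ p : q.queryGraph.Walk u v, ∃ w ∈ p.support, (w : V) ∈ R.key ∪ q.frozen

/-- `x` is an id-set for `q`. -/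
def IsIdSet (q : ConjQuery σ V C) (x : Set V) : Prop :=
  x ⊆ q.bound ∧ q.SourceCondition x ∧ q.SeparationCondition x

/-- Membership in the class Cparsimony: the attack graph is acyclic and has no strong attacks, and
there is an id-set. -/
def InCparsimony (q : ConjQuery σ V C) : Prop :=
  q.AttackAcyclic ∧ (∀ F G : q.body, ¬ q.StrongAttacks F G) ∧ ∃ x, q.IsIdSet x

end ConjQuery

/-! Functional dependencies are handled as derivations (`AtomClosure`). The pivot is
`AttacksVar.mem_of_closure`: if `G` attacks `w`, every derivation of `w` from variables that `G`
does not attack must use `G`.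

Sufficiency. Let `x` be an id-set. An acyclic attack graph yields rewritings by eliminating
unattacked atoms one at a time, and freeing `x` creates no attacks. Unattacked atoms of one
component determine each other's keys and, the attacks being weak, all other keys, so `x` determines
every variable and a repair has as many full answers as answers on `x`. Variables of `x` are
unattacked, so exchanging facts between repairs leads to a repair whose answers on `x` are exactly
the consistent ones (`exists_repair_forall_answer`): this is the lower bound. For the upper bound,
certainty forces a single value on each frozen variable (`Certain.eqOn_frozen`). Embeddings can then
be added one by one to a consistent set of facts: a conflict at an atom `R` is resolved by
overwriting a valuation only on variables reachable from `notKey R` outside `key R` and the frozen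
variables, which by separation misses `x` (`exists_insert_embedding`).

Necessity. Each failure is refuted by a database made of two or three copies of the body. If `x`
does not determine the query, two full answers share one tuple on `x`; if a variable of `x` is
attacked, the query is certain although no tuple on `x` is. Hence `x` is unattacked and determines
everything, from which acyclicity, absence of strong attacks and the source condition follow by
following derivations. If separation fails, the three tuples on `x` are answers on the database, but
no repair has them all. -/

/-! ### Derivations of variables, and attacks -/

/-- The variables derivable from `Z` by repeatedly adding the variables of an atom in `B` whose key has
already been derived. -/
inductive AtomClosure {σ : Schema} {V C : Type*} (B : Set (QAtom σ V C)) (Z : Set V) : V → Prop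
  | base {v : V} : v ∈ Z → AtomClosure B Z v
  | step {v : V} {F : QAtom σ V C} : F ∈ B → (∀ u ∈ F.key, AtomClosure B Z u) → v ∈ F.vars →
      AtomClosure B Z v

namespace AtomClosure

variable {σ : Schema} {V C : Type*}

theorem trans {B B' : Set (QAtom σ V C)} {Z Z' : Set V} {v : V} (h : AtomClosure B Z v)
    (hB : B ⊆ B') (hZ : ∀ z ∈ Z, AtomClosure B' Z' z) : AtomClosure B' Z' v := by
  induction h with
  | base h => exact hZ _ h
  | step hF _ hv ih => exact step (hB hF) ih hv

theorem mono {B B' : Set (QAtom σ V C)} {Z Z' : Set V} {v : V} (h : AtomClosure B Z v)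
    (hB : B ⊆ B') (hZ : Z ⊆ Z') : AtomClosure B' Z' v :=
  h.trans hB fun _ hz => base (hZ hz)

end AtomClosure

namespace RelAtom

variable {σ : Schema} {V C : Type*}

theorem key_subset_vars (F : QAtom σ V C) : F.key ⊆ F.vars := fun _ ⟨i, _, h⟩ => ⟨i, h⟩

theorem finite_vars (F : QAtom σ V C) : F.vars.Finite := by
  have : F.vars ⊆ Sum.inl ⁻¹' (Set.range F.args) := fun v ⟨i, h⟩ => ⟨i, h⟩
  exact ((Set.finite_range F.args).preimage Sum.inl_injective.injOn).subset this

end RelAtom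

namespace ConjQuery

variable {σ : Schema} {V C : Type*} (q : ConjQuery σ V C)

theorem finite_vars : q.vars.Finite := by
  have : q.vars = ⋃ F ∈ q.body, F.vars := by ext; simp [vars]
  rw [this]
  exact q.finite_body.biUnion fun F _ => F.finite_vars

/-- Armstrong's completeness argument: if `w` is not derivable, the two-tuple relation formed by the
zero tuple and the indicator of the non-derivable variables satisfies `fdSet` and violates the
dependency. -/
theorem fdImplies_fdSet_iff (Z W : Set V) :
    FDImplies q.fdSet Z W ↔ ∀ w ∈ W, AtomClosure q.body (q.free ∪ Z) w := by
  classical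
  constructor
  · intro h w hw
    by_contra hc
    let t : V → ℕ := fun v => if AtomClosure q.body (q.free ∪ Z) v then 0 else 1
    have ht : ∀ v, (0 : ℕ) = t v ↔ AtomClosure q.body (q.free ∪ Z) v := by
      intro v; by_cases hv : AtomClosure q.body (q.free ∪ Z) v <;> simp [t, hv]
    have holds : ∀ f : FunDep V, ((∀ v ∈ f.lhs, AtomClosure q.body (q.free ∪ Z) v) →
        ∀ v ∈ f.rhs, AtomClosure q.body (q.free ∪ Z) v) → f.Holds {fun _ => 0, t} := by
      intro f hf a ha b hb hab v hv
      rcases ha with rfl | rfl <;> rcases hb with rfl | rfl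
      · rfl
      · exact (ht v).2 (hf (fun u hu => (ht u).1 (hab u hu)) v hv)
      · exact ((ht v).2 (hf (fun u hu => (ht u).1 (hab u hu).symm) v hv)).symm
      · rfl
    have := h {fun _ => 0, t} (by
      rintro f (rfl | ⟨F, hF, rfl⟩)
      · exact holds _ fun _ v hv => .base (.inl hv)
      · exact holds _ fun h v hv => .step hF h hv) _ (.inl rfl) _ (.inr rfl)
      (fun v hv => (ht v).2 (.base (.inr hv))) w hw
    exact hc ((ht w).1 this)
  · intro h I hI s hs t ht hst w hw
    have hw' := h w hw
    clear hw h
    induction hw' with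
    | base hz =>
      rcases hz with hz | hz
      · exact hI _ (.inl rfl) s hs t ht (by simp) _ hz
      · exact hst _ hz
    | step hF _ hv ih => exact hI _ (.inr ⟨_, hF, rfl⟩) s hs t ht ih _ hv

/-- `remove` forgets free variables that occur in no remaining atom. They are harmless: a derivation
step only consults keys of remaining atoms. -/
theorem mem_keyClosure_iff {F : QAtom σ V C} {y : V} :
    y ∈ q.keyClosure F ↔ y ∈ q.vars ∧ AtomClosure (q.body \ {F}) (q.free ∪ F.key) y := by
  rw [keyClosure, Set.mem_ofPred_eq, fdImplies_fdSet_iff]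
  refine and_congr_right fun hy => ⟨?_, ?_⟩
  · rintro (h | h)
    · exact .base (.inl h)
    · exact (h y rfl).mono subset_rfl (Set.union_subset_union_left _ Set.inter_subset_left)
  · intro h
    have key : y ∈ q.free ∨ AtomClosure (q.remove F).body ((q.remove F).free ∪ F.key) y := by
      clear hy
      induction h with
      | base h => exact h.imp_right fun h => .base (.inr h)
      | step hE _ hv ih =>
        refine .inr (.step hE (fun u hu => ?_) hv)
        rcases ih u hu with h | h
        · exact .base (.inl ⟨h, _, hE, RelAtom.key_subset_vars _ hu⟩)
        · exact h
    simpa using key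

/-- Reachability in the query graph from a variable in `notKey F`, by bound variables outside `S`. -/
inductive Reach (F : QAtom σ V C) (S : Set V) : V → Prop
  | base {u : V} : u ∈ F.notKey → u ∈ q.bound → u ∉ S → Reach F S u
  | step {u v : V} : Reach F S u → q.OccurTogether u v → v ∈ q.bound → v ∉ S → Reach F S v

variable {q}

theorem Reach.mem_bound {F : QAtom σ V C} {S : Set V} {v : V} (h : q.Reach F S v) : v ∈ q.bound := by
  cases h <;> assumption

theorem Reach.notMem {F : QAtom σ V C} {S : Set V} {v : V} (h : q.Reach F S v) : v ∉ S := by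
  cases h <;> assumption

theorem OccurTogether.symm {u v : V} (h : q.OccurTogether u v) : q.OccurTogether v u :=
  h.imp fun _ h => ⟨h.1, h.2.2, h.2.1⟩

theorem attacksVar_iff {F : QAtom σ V C} {x : V} :
    q.AttacksVar F x ↔ q.Reach F (q.keyClosure F) x := by
  constructor
  · rintro ⟨u, l, hl, hu, rfl, hv⟩
    have hr : q.Reach F (q.keyClosure F) u := .base hu (hv u (by simp)).1 (hv u (by simp)).2
    clear hu
    induction l generalizing u with
    | nil => simpa using hr
    | cons a l ih =>
      rw [List.isChain_cons_cons] at hl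
      rw [List.getLast_cons (List.cons_ne_nil a l)]
      refine ih a hl.2 (fun v h => hv v (.tail _ h)) ?_
      exact .step hr hl.1 (hv a (by simp)).1 (hv a (by simp)).2
  · intro h
    induction h with
    | @base u h1 h2 h3 => exact ⟨u, [], by simp, h1, by simp, by simp [h2, h3]⟩
    | @step u v h1 h2 h3 h4 ih =>
      obtain ⟨a, l, hl, ha, hlast, hall⟩ := ih
      refine ⟨a, l ++ [v], ?_, ha, ?_, ?_⟩
      · rw [← List.cons_append, List.isChain_append]
        refine ⟨hl, by simp, ?_⟩
        intro x hx y hy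
        rw [List.getLast?_eq_getLast_of_ne_nil (List.cons_ne_nil a l), hlast] at hx
        simp at hx hy
        subst hx hy
        exact h2
      · simp
      · intro w hw
        rw [← List.cons_append, List.mem_append, List.mem_singleton] at hw
        rcases hw with hw | rfl
        · exact hall w hw
        · exact ⟨h3, h4⟩

theorem AttacksVar.mem_bound {F : QAtom σ V C} {v : V} (h : q.AttacksVar F v) : v ∈ q.bound :=
  (attacksVar_iff.1 h).mem_bound

theorem AttacksVar.notMem {F : QAtom σ V C} {v : V} (h : q.AttacksVar F v) :
    v ∉ q.keyClosure F :=
  (attacksVar_iff.1 h).notMem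

theorem AttacksVar.not_closure {F : QAtom σ V C} {v : V} (h : q.AttacksVar F v) :
    ¬ AtomClosure (q.body \ {F}) (q.free ∪ F.key) v :=
  fun hc => h.notMem (q.mem_keyClosure_iff.2 ⟨h.mem_bound.1, hc⟩)

/-- A variable that occurs together with an attacked variable is itself attacked, or belongs to the
key closure. -/
theorem AttacksVar.adj {F : QAtom σ V C} {u v : V} (h : q.AttacksVar F u)
    (huv : q.OccurTogether u v) :
    q.AttacksVar F v ∨ AtomClosure (q.body \ {F}) (q.free ∪ F.key) v := by
  by_contra! hc
  have hv : v ∈ q.vars := huv.imp fun _ h => ⟨h.1, h.2.2⟩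
  refine hc.1 (attacksVar_iff.2 (.step (attacksVar_iff.1 h) huv ⟨hv, fun hf => ?_⟩ fun hf => ?_))
  · exact hc.2 (.base (.inl hf))
  · exact hc.2 (q.mem_keyClosure_iff.1 hf).2

theorem not_attacksVar_key {F : QAtom σ V C} {v : V} (hv : v ∈ F.key) : ¬ q.AttacksVar F v :=
  fun h => h.not_closure (.base (.inr hv))

/-- A derivation of a variable attacked by `G` from variables that `G` does not attack uses `G`. -/
theorem AttacksVar.mem_of_closure {B : Set (QAtom σ V C)} (hB : B ⊆ q.body) {Z : Set V}
    {G : QAtom σ V C} {w : V} (hw : AtomClosure B Z w) (hG : q.AttacksVar G w)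
    (hZ : ∀ z ∈ Z, ¬ q.AttacksVar G z) : G ∈ B ∧ ∀ k ∈ G.key, AtomClosure B Z k := by
  induction hw with
  | base h => exact absurd hG (hZ _ h)
  | @step v E hE hk hv ih =>
    by_cases hEG : E = G
    · subst hEG; exact ⟨hE, hk⟩
    by_cases hex : ∃ u ∈ E.key, q.AttacksVar G u
    · obtain ⟨u, hu, hGu⟩ := hex
      exact ih u hu hGu
    push Not at hex
    -- With no key variable of `E` attacked, the whole key lies in the key closure of `G`, and so
    -- does the attacked variable `v`: a contradiction.
    refine absurd (.step (F := E) ⟨hB hE, hEG⟩ (fun u hu => ?_) hv) hG.not_closure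
    exact (hG.adj ⟨E, hB hE, hv, RelAtom.key_subset_vars _ hu⟩).resolve_left (hex u hu)

theorem not_attacksVar_free {F : QAtom σ V C} {v : V} (hv : v ∈ q.free) : ¬ q.AttacksVar F v :=
  fun h => h.mem_bound.2 hv

theorem AttacksVar.exists_key {F G : QAtom σ V C} (hG : G ∈ q.body) (hne : F ≠ G) {v : V}
    (hv : v ∈ G.vars) (h : q.AttacksVar F v) : ∃ k ∈ G.key, q.AttacksVar F k := by
  by_contra! hc
  refine h.not_closure (.step (F := G) ⟨hG, hne.symm⟩ (fun u hu => ?_) hv)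
  exact (h.adj ⟨G, hG, hv, RelAtom.key_subset_vars _ hu⟩).resolve_left (hc u hu)

/-- A variable attacked by `G` is not in the key closure of `F`: its derivation from `key F`, which
`G` does not attack, would use `G` and thus derive `y`, which `F` attacks. So witnesses of `G`
prolong the witness of `F` that ends in `y`. -/
theorem Attacks.trans {F G H : q.body} (hFG : q.Attacks F G) (hGH : q.Attacks G H)
    (hGF : ¬ q.Attacks G F) : q.Attacks F H := by
  obtain ⟨hne, y, hy, hFy⟩ := hFG
  have hGF' : ∀ z ∈ (F : QAtom σ V C).vars, ¬ q.AttacksVar G z :=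
    fun z hz h => hGF ⟨hne.symm, z, hz, h⟩
  have hclos : ∀ w, q.AttacksVar G w → w ∉ q.keyClosure F := by
    intro w hw hcl
    have := hw.mem_of_closure Set.sdiff_subset (q.mem_keyClosure_iff.1 hcl).2 (by
      rintro z (hz | hz)
      · exact not_attacksVar_free hz
      · exact hGF' z (RelAtom.key_subset_vars _ hz))
    exact hFy.not_closure (.step this.1 this.2 hy)
  have hall : ∀ w, q.AttacksVar G w → q.AttacksVar F w := by
    intro w hw
    rw [attacksVar_iff] at hw
    induction hw with
    | @base w h1 h2 h3 =>
      have := hclos w (attacksVar_iff.2 (.base h1 h2 h3))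
      exact attacksVar_iff.2 (.step (attacksVar_iff.1 hFy) ⟨G, G.2, hy, h1.1⟩ h2 this)
    | @step w v h1 h2 h3 h4 ih =>
      have := hclos v (attacksVar_iff.2 (.step h1 h2 h3 h4))
      exact attacksVar_iff.2 (.step (attacksVar_iff.1 ih) h2 h3 this)
  obtain ⟨hne', z, hz, hGz⟩ := hGH
  refine ⟨?_, z, hz, hall z hGz⟩
  rintro rfl
  exact hGF ⟨hne', z, hz, hGz⟩

/-- If two atoms attack a common atom but not each other, their keys determine each other. -/
theorem closure_key_of_attacks {F G H : q.body} (hFH : q.Attacks F H) (hGH : q.Attacks G H)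
    (hFG : ¬ q.Attacks F G) (hGF : ¬ q.Attacks G F) :
    ∀ k ∈ (G : QAtom σ V C).key, AtomClosure q.body (q.free ∪ (F : QAtom σ V C).key) k := by
  by_cases hne : F = G
  · subst hne
    exact fun k hk => .base (.inr hk)
  by_contra hc
  have hclos : ∀ w, q.AttacksVar G w → w ∉ q.keyClosure F := by
    intro w hw hcl
    have := hw.mem_of_closure Set.sdiff_subset (q.mem_keyClosure_iff.1 hcl).2 (by
      rintro z (hz | hz)
      · exact not_attacksVar_free hz
      · exact fun h => hGF ⟨Ne.symm hne, z, RelAtom.key_subset_vars _ hz, h⟩)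
    exact hc fun k hk => (this.2 k hk).mono Set.sdiff_subset subset_rfl
  obtain ⟨-, y, hy, hFy⟩ := hFH
  obtain ⟨-, z, hz, hGz⟩ := hGH
  have hFz : q.AttacksVar F z := attacksVar_iff.2
    (.step (attacksVar_iff.1 hFy) ⟨H, H.2, hy, hz⟩ hGz.mem_bound (hclos z hGz))
  -- Walking backwards along the witness from `G` to `z`, the attack of `F` is carried down to
  -- `notKey G`, so `F` would attack `G`.
  have : ∀ w, q.Reach G (q.keyClosure G) w → q.AttacksVar F w →
      ∃ z ∈ (G : QAtom σ V C).vars, q.AttacksVar F z := by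
    intro w hw
    induction hw with
    | @base u h1 h2 h3 => exact fun h => ⟨u, h1.1, h⟩
    | @step u v h1 h2 h3 h4 ih =>
      intro hv
      exact ih (attacksVar_iff.2 (.step (attacksVar_iff.1 hv) h2.symm h1.mem_bound
        (hclos u (attacksVar_iff.2 h1))))
  exact hFG ⟨hne, this z (attacksVar_iff.1 hGz) hFz⟩

theorem finite_subtype_body (q : ConjQuery σ V C) : Finite q.body := q.finite_body.to_subtype

theorem AttackAcyclic.exists_unattacked (hq : q.AttackAcyclic) (H : q.body) :
    ∃ U : q.body, q.Unattacked U ∧ (U = H ∨ q.Attacks U H) := by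
  have := q.finite_subtype_body
  have : IsTrans q.body (Relation.TransGen q.Attacks) := ⟨fun _ _ _ => Relation.TransGen.trans⟩
  have : Std.Irrefl (Relation.TransGen q.Attacks) := ⟨hq⟩
  have wf := Finite.wellFounded_of_trans_of_irrefl (Relation.TransGen q.Attacks)
  induction H using wf.induction with
  | _ H ih =>
    by_cases hH : q.Unattacked H
    · exact ⟨H, hH, .inl rfl⟩
    · simp only [Unattacked, not_forall, not_not] at hH
      obtain ⟨G, hG⟩ := hH
      -- Since `U` is unattacked, `Attacks.trans` shortens the chain from `U` through `G` to a
      -- direct attack on `H`.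
      obtain ⟨U, hU, h⟩ := ih G (.single hG)
      refine ⟨U, hU, .inr ?_⟩
      rcases h with rfl | h
      · exact hG
      · exact h.trans hG (hU G)

/-! ### Sequential proofs -/

theorem IsSequentialProof.closure {Z : Set V} {l : List (QAtom σ V C)}
    (h : q.IsSequentialProof Z l) {v : V} (hv : v ∈ q.derived Z l) :
    AtomClosure {F | F ∈ l} (q.free ∪ Z) v := by
  have key : ∀ i (hi : i < l.length), ∀ w ∈ (l[i]).vars, AtomClosure {F | F ∈ l} (q.free ∪ Z) w := by
    intro i
    induction i using Nat.strong_induction_on with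
    | _ i ih =>
      intro hi w hw
      refine .step (List.getElem_mem hi) (fun u hu => ?_) hw
      rcases h.2 i hi hu with hu | ⟨F, hF, hu⟩
      · exact .base hu
      · obtain ⟨j, hj, rfl⟩ := List.getElem_of_mem hF
        rw [List.length_take] at hj
        rw [List.getElem_take] at hu
        exact ih j (by omega) (by omega) u hu
  rcases hv with hv | ⟨F, hF, hv⟩
  · exact .base hv
  · obtain ⟨j, hj, rfl⟩ := List.getElem_of_mem hF
    exact key j hj v hv

theorem derived_mono (Z : Set V) {l l' : List (QAtom σ V C)} (h : l ⊆ l') :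
    q.derived Z l ⊆ q.derived Z l' := by
  rintro v (hv | ⟨F, hF, hv⟩)
  · exact .inl hv
  · exact .inr ⟨F, h hF, hv⟩

theorem IsSequentialProof.append {Z : Set V} {l l' : List (QAtom σ V C)}
    (h : q.IsSequentialProof Z l) (h' : q.IsSequentialProof Z l') :
    q.IsSequentialProof Z (l ++ l') := by
  refine ⟨fun F hF => (List.mem_append.1 hF).elim (h.1 F) (h'.1 F), fun i hi => ?_⟩
  by_cases hil : i < l.length
  · rw [List.getElem_append_left hil, List.take_append_of_le_length hil.le]
    exact h.2 i hil
  · push Not at hil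
    rw [List.getElem_append_right hil, List.take_append]
    exact (h'.2 _ _).trans (derived_mono Z (List.subset_append_right _ _))

theorem IsSequentialProof.snoc {Z : Set V} {l : List (QAtom σ V C)}
    (h : q.IsSequentialProof Z l) {F : QAtom σ V C} (hF : F ∈ q.body)
    (hk : F.key ⊆ q.derived Z l) : q.IsSequentialProof Z (l ++ [F]) := by
  refine ⟨fun G hG => ?_, fun i hi => ?_⟩
  · rcases List.mem_append.1 hG with hG | hG
    · exact h.1 G hG
    · rwa [List.mem_singleton.1 hG]
  by_cases hil : i < l.length
  · rw [List.getElem_append_left hil, List.take_append_of_le_length hil.le]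
    exact h.2 i hil
  · have : i = l.length := by simp at hi; omega
    subst this
    simpa using hk

theorem exists_isSequentialProof {Z : Set V} {v : V} (h : AtomClosure q.body (q.free ∪ Z) v) :
    ∃ l, q.IsSequentialProof Z l ∧ v ∈ q.derived Z l := by
  induction h with
  | base h => exact ⟨[], ⟨by simp, by simp⟩, .inl h⟩
  | @step v F hF _ hv ih =>
    have : ∀ K : Set V, K.Finite → K ⊆ F.key →
        ∃ l, q.IsSequentialProof Z l ∧ K ⊆ q.derived Z l := by
      intro K hK
      induction K, hK using Set.Finite.induction_on with
      | empty => exact fun _ => ⟨[], ⟨by simp, by simp⟩, by simp⟩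
      | @insert a s _ _ ihs =>
        intro hs
        obtain ⟨l, hl, hsl⟩ := ihs ((Set.subset_insert a s).trans hs)
        obtain ⟨l', hl', hal⟩ := ih a (hs (Set.mem_insert a s))
        refine ⟨l ++ l', hl.append hl', Set.insert_subset ?_ ?_⟩
        · exact derived_mono Z (List.subset_append_right _ _) hal
        · exact hsl.trans (derived_mono Z (List.subset_append_left _ _))
    obtain ⟨l, hl, hk⟩ := this F.key (F.finite_vars.subset F.key_subset_vars) subset_rfl
    exact ⟨l ++ [F], hl.snoc hF hk, .inr ⟨F, by simp, hv⟩⟩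

/-- One proof free of attackers excludes all attackers: an atom attacking `v` would have to occur in
every derivation of `v`, in particular in that one. -/
theorem not_attacksVar_frozen {v : V} (hv : v ∈ q.frozen) (R : QAtom σ V C) :
    ¬ q.AttacksVar R v := by
  intro hR
  obtain ⟨-, l, hl, hvl, hatt⟩ := hv
  have := hR.mem_of_closure (B := {F | F ∈ l}) hl.1 (hl.closure hvl) (by
    rintro z (hz | hz)
    · exact not_attacksVar_free hz
    · exact hz.elim)
  exact hatt R this.1 hR

theorem frozen_closure {v : V} (hv : v ∈ q.frozen) : AtomClosure q.body q.free v := by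
  obtain ⟨-, l, hl, hvl, -⟩ := hv
  exact (hl.closure hvl).mono hl.1 (by simp)

theorem mem_frozen_of_not_attacksVar {v : V} (hv : v ∈ q.vars)
    (hc : AtomClosure q.body q.free v) (h : ∀ F ∈ q.body, ¬ q.AttacksVar F v) : v ∈ q.frozen := by
  obtain ⟨l, hl, hvl⟩ := exists_isSequentialProof (q := q) (Z := ∅) (v := v) (by simpa using hc)
  exact ⟨hv, l, hl, hvl, fun F hF => h F (hl.1 F hF)⟩

/-- A variable derivable from the free ones that is not frozen is attacked by an atom whose key is
derivable from the free variables. -/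
theorem exists_attacksVar_of_notMem_frozen {v : V} (hv : v ∈ q.vars)
    (hc : AtomClosure q.body q.free v) (h : v ∉ q.frozen) :
    ∃ E ∈ q.body, q.AttacksVar E v ∧ ∀ k ∈ E.key, AtomClosure q.body q.free k := by
  by_contra! hcon
  refine h (mem_frozen_of_not_attacksVar hv hc fun E hE hEv => ?_)
  obtain ⟨k, hk, hk'⟩ := hcon E hE hEv
  exact hk' ((hEv.mem_of_closure subset_rfl hc fun z hz => not_attacksVar_free hz).2 k hk)

end ConjQuery

/-! ### Key-equality and repairs -/

namespace RelAtom

variable {σ : Schema} {V C T : Type*}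

/-- The relation name together with the entries at the primary-key positions. -/
def blockKey (A : RelAtom σ T) :
    Σ R : σ.Rel, ({i : Fin (σ.arity R) // (i : ℕ) < σ.keyLen R} → T) :=
  ⟨A.rel, fun i => A.args i⟩

theorem keyEqual_iff {A B : RelAtom σ T} : A.KeyEqual B ↔ A.blockKey = B.blockKey := by
  obtain ⟨R, a⟩ := A
  obtain ⟨R', b⟩ := B
  constructor
  · rintro ⟨h, hab⟩
    dsimp only at h
    subst h
    simp only [blockKey, Sigma.mk.injEq, heq_eq_eq, true_and]
    funext i
    exact hab i i.2
  · intro h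
    simp only [blockKey, Sigma.mk.injEq] at h
    obtain ⟨h, h'⟩ := h
    subst h
    exact ⟨rfl, fun i hi => congrFun (eq_of_heq h') ⟨i, hi⟩⟩

theorem KeyEqual.rfl {A : RelAtom σ T} : A.KeyEqual A := keyEqual_iff.2 _root_.rfl

theorem KeyEqual.symm {A B : RelAtom σ T} (h : A.KeyEqual B) : B.KeyEqual A :=
  keyEqual_iff.2 (keyEqual_iff.1 h).symm

theorem KeyEqual.trans {A B D : RelAtom σ T} (h : A.KeyEqual B) (h' : B.KeyEqual D) :
    A.KeyEqual D :=
  keyEqual_iff.2 ((keyEqual_iff.1 h).trans (keyEqual_iff.1 h'))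

theorem inst_eq_inst_iff {F : QAtom σ V C} {μ ν : V → C} :
    F.inst μ = F.inst ν ↔ ∀ v ∈ F.vars, μ v = ν v := by
  simp only [inst, RelAtom.mk.injEq, heq_eq_eq, true_and]
  constructor
  · rintro h v ⟨i, hi⟩
    simpa [hi] using congrFun h i
  · intro h
    funext i
    cases hi : F.args i with
    | inl v => simpa using h v ⟨i, hi⟩
    | inr c => simp

theorem inst_keyEqual_inst_iff {F : QAtom σ V C} {μ ν : V → C} :
    (F.inst μ).KeyEqual (F.inst ν) ↔ ∀ v ∈ F.key, μ v = ν v := by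
  constructor
  · rintro ⟨_, hk⟩ v ⟨i, hi, hiv⟩
    have : Sum.elim μ id (F.args i) = Sum.elim ν id (F.args i) := hk i hi
    simpa [hiv] using this
  · intro h
    refine ⟨_root_.rfl, fun i hi => ?_⟩
    change Sum.elim μ id (F.args i) = Sum.elim ν id (F.args i)
    cases hiv : F.args i with
    | inl v => simpa using h v ⟨i, hi, hiv⟩
    | inr c => simp

end RelAtom

namespace Database

variable {σ : Schema} {C : Type*}

theorem exists_repair_superset {db s : Database σ C} (hs : s ⊆ db) (hc : s.Consistent) :
    ∃ r, db.IsRepair r ∧ s ⊆ r := by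
  have hfin : {t : Database σ C | t ⊆ db ∧ t.Consistent}.Finite :=
    db.powerset.finite_toSet.subset fun t ht => Finset.mem_coe.2 (Finset.mem_powerset.2 ht.1)
  obtain ⟨r, hsr, hr⟩ := hfin.exists_le_maximal (a := s) ⟨hs, hc⟩
  exact ⟨r, hr, hsr⟩

theorem exists_repair (db : Database σ C) : ∃ r, db.IsRepair r := by
  obtain ⟨r, hr, -⟩ := exists_repair_superset (Finset.empty_subset db)
    (fun A hA => absurd hA (Finset.notMem_empty A))
  exact ⟨r, hr⟩

theorem IsRepair.subset {db r : Database σ C} (h : db.IsRepair r) : r ⊆ db := h.prop.1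

theorem IsRepair.consistent {db r : Database σ C} (h : db.IsRepair r) : r.Consistent := h.prop.2

theorem IsRepair.exists_keyEqual {db r : Database σ C} (h : db.IsRepair r) {A : DBFact σ C}
    (hA : A ∈ db) : ∃ B ∈ r, A.KeyEqual B := by
  classical
  by_contra! hc
  have hins : insert A r ⊆ db ∧ Database.Consistent (insert A r) := by
    refine ⟨Finset.insert_subset hA h.subset, ?_⟩
    intro X hX Y hY hXY
    rw [Finset.mem_insert] at hX hY
    rcases hX with rfl | hX <;> rcases hY with rfl | hY
    · rfl
    · exact absurd hXY (hc Y hY)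
    · exact absurd hXY.symm (hc X hX)
    · exact h.consistent X hX Y hY hXY
  have := h.2 hins (Finset.subset_insert A r) (Finset.mem_insert_self A r)
  exact hc A this .rfl

theorem isRepair_iff {db r : Database σ C} :
    db.IsRepair r ↔ r ⊆ db ∧ r.Consistent ∧ ∀ A ∈ db, ∃ B ∈ r, A.KeyEqual B := by
  refine ⟨fun h => ⟨h.subset, h.consistent, fun A hA => h.exists_keyEqual hA⟩, ?_⟩
  rintro ⟨h1, h2, h3⟩
  refine ⟨⟨h1, h2⟩, fun s hs hrs A hA => ?_⟩
  obtain ⟨B, hB, hAB⟩ := h3 A (hs.1 hA)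
  rwa [hs.2 A hA B (hrs hB) hAB]

theorem IsRepair.mem_of_forall {db r : Database σ C} (h : db.IsRepair r) {A : DBFact σ C}
    (hA : A ∈ db) (hu : ∀ B ∈ db, A.KeyEqual B → A = B) : A ∈ r := by
  obtain ⟨B, hB, hAB⟩ := h.exists_keyEqual hA
  rwa [hu B (h.subset hB) hAB]

open Classical in
theorem IsRepair.swap {db r : Database σ C} (h : db.IsRepair r) {A B : DBFact σ C} (hA : A ∈ r)
    (hB : B ∈ db) (hAB : A.KeyEqual B) : db.IsRepair (insert B (r.erase A)) := by
  refine isRepair_iff.2 ⟨?_, ?_, fun X hX => ?_⟩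
  · exact Finset.insert_subset hB ((Finset.erase_subset _ _).trans h.subset)
  · have aux : ∀ X ∈ r.erase A, ¬ X.KeyEqual B := by
      intro X hX hXB
      rw [Finset.mem_erase] at hX
      exact hX.1 (h.consistent X hX.2 A hA (hXB.trans hAB.symm))
    intro X hX Y hY hXY
    rw [Finset.mem_insert] at hX hY
    rcases hX with rfl | hX <;> rcases hY with rfl | hY
    · rfl
    · exact absurd hXY.symm (aux Y hY)
    · exact absurd hXY (aux X hX)
    · exact h.consistent X (Finset.mem_of_mem_erase hX) Y (Finset.mem_of_mem_erase hY) hXY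
  · obtain ⟨Y, hY, hXY⟩ := h.exists_keyEqual hX
    by_cases hYA : Y = A
    · subst hYA
      exact ⟨B, Finset.mem_insert_self _ _, hXY.trans hAB⟩
    · exact ⟨Y, Finset.mem_insert_of_mem (Finset.mem_erase.2 ⟨hYA, hY⟩), hXY⟩

end Database

/-! ### Embeddings, and repairs with the fewest answers -/

namespace ConjQuery

variable {σ : Schema} {V C : Type*} (q : ConjQuery σ V C)

/-- The valuation `μ` maps every atom of `q` to a fact of `db`. -/
def Embeds (db : Database σ C) (μ : V → C) : Prop := ∀ F ∈ q.body, F.inst μ ∈ db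

/-- Some valuation that extends `c` on the free variables and `d` on `X` embeds `q` in `db`. -/
def Answer (X : Set V) (db : Database σ C) (c d : V → C) : Prop :=
  ∃ μ, q.Embeds db μ ∧ Set.EqOn μ c q.free ∧ Set.EqOn μ d X

variable {q}

theorem Embeds.mono {db db' : Database σ C} {μ : V → C} (h : q.Embeds db μ) (hs : db ⊆ db') :
    q.Embeds db' μ := fun F hF => hs (h F hF)

theorem SelfJoinFree.eq_of_keyEqual (hq : q.SelfJoinFree) {F G : QAtom σ V C} (hF : F ∈ q.body)
    (hG : G ∈ q.body) {μ ν : V → C} (h : (F.inst μ).KeyEqual (G.inst ν)) : F = G :=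
  hq F hF G hG h.1

/-- Valuations into a consistent database satisfy the functional dependencies of the query. -/
theorem _root_.Database.Consistent.eq_of_closure {r : Database σ C} (hr : r.Consistent)
    {B : Set (QAtom σ V C)} {Z : Set V} {μ ν : V → C} (hμ : ∀ G ∈ B, G.inst μ ∈ r)
    (hν : ∀ G ∈ B, G.inst ν ∈ r) (hZ : Set.EqOn μ ν Z) {v : V} (hv : AtomClosure B Z v) :
    μ v = ν v := by
  induction hv with
  | base h => exact hZ h
  | step hF _ hv ih =>
    exact RelAtom.inst_eq_inst_iff.1
      (hr _ (hμ _ hF) _ (hν _ hF) (RelAtom.inst_keyEqual_inst_iff.2 ih)) _ hv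

open Classical in
/-- Two valuations can be combined along the variables reachable from `R`. -/
theorem exists_mix {R : QAtom σ V C} (hR : R ∈ q.body) {S : Set V} (hRS : R.key ⊆ S)
    {μ ν : V → C} (hS : ∀ v ∈ q.vars, v ∈ q.free ∨ v ∈ S → μ v = ν v) :
    ∃ κ : V → C, R.inst κ = R.inst μ ∧
      (∀ G ∈ q.body, G.inst κ = G.inst μ ∨ G.inst κ = G.inst ν) ∧
      ∀ v, ¬ q.Reach R S v → κ v = ν v := by
  -- An atom containing a reachable variable has its other variables reachable, free or in `S`, so
  -- it cannot tell this mixture from `μ`; an atom without reachable variables sees only `ν`.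
  refine ⟨fun v => if q.Reach R S v then μ v else ν v, ?_, fun G hG => ?_, fun v hv => by simp [hv]⟩
  · refine RelAtom.inst_eq_inst_iff.2 fun v hv => ?_
    by_cases h : q.Reach R S v
    · simp [h]
    · simp only [h, if_false]
      refine (hS v ⟨R, hR, hv⟩ ?_).symm
      by_contra! hc
      exact h (.base ⟨hv, fun hk => hc.2 (hRS hk)⟩ ⟨⟨R, hR, hv⟩, hc.1⟩ hc.2)
  · by_cases hex : ∃ w ∈ G.vars, q.Reach R S w
    · obtain ⟨w, hw, hRw⟩ := hex
      left
      refine RelAtom.inst_eq_inst_iff.2 fun v hv => ?_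
      by_cases h : q.Reach R S v
      · simp [h]
      · simp only [h, if_false]
        refine (hS v ⟨G, hG, hv⟩ ?_).symm
        by_contra! hc
        exact h (.step hRw ⟨G, hG, hw, hv⟩ ⟨⟨G, hG, hv⟩, hc.1⟩ hc.2)
    · right
      push Not at hex
      exact RelAtom.inst_eq_inst_iff.2 fun v hv => by simp [hex v hv]

theorem key_subset_keyClosure {R : QAtom σ V C} (hR : R ∈ q.body) : R.key ⊆ q.keyClosure R :=
  fun _ hv => q.mem_keyClosure_iff.2 ⟨⟨R, hR, R.key_subset_vars hv⟩, .base (.inr hv)⟩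

open Classical in
/-- Replacing a relevant `R`-fact by a key-equal fact creates no new answers on variables that `R`
does not attack. -/
theorem answer_of_answer_swap (hq : q.SelfJoinFree) {X : Set V} {R : QAtom σ V C} (hR : R ∈ q.body)
    (hX : ∀ v ∈ X, ¬ q.AttacksVar R v) {c : V → C} {r : Database σ C} (hr : r.Consistent)
    {μ : V → C} (hμ : q.Embeds r μ) (hμc : Set.EqOn μ c q.free) {B : DBFact σ C}
    (hAB : (R.inst μ).KeyEqual B) {d : V → C}
    (h : q.Answer X (insert B (r.erase (R.inst μ))) c d) : q.Answer X r c d := by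
  obtain ⟨ν, hν, hνc, hνd⟩ := h
  have hmem : ∀ G ∈ q.body, G ≠ R → G.inst ν ∈ r := by
    intro G hG hGR
    have := hν G hG
    rw [Finset.mem_insert] at this
    rcases this with h | h
    · exact absurd (hq G hG R hR (by rw [← h] at hAB; exact hAB.1.symm)) hGR
    · exact Finset.mem_of_mem_erase h
  -- If `ν` uses the new fact, `μ` and `ν` agree on `key R`, hence on the key closure, since all
  -- other facts involved are in the consistent set `r`. Mixing restores the old `R`-fact and
  -- changes `ν` only on variables that `R` attacks.
  by_cases hRB : R.inst ν = B
  · have hkey : ∀ v ∈ R.key, μ v = ν v := by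
      rw [← hRB] at hAB
      exact RelAtom.inst_keyEqual_inst_iff.1 hAB
    have hfree : Set.EqOn μ ν q.free := fun v hv => (hμc hv).trans (hνc hv).symm
    have hS : ∀ v ∈ q.vars, v ∈ q.free ∨ v ∈ q.keyClosure R → μ v = ν v := by
      rintro _ - (hv | hv)
      · exact hfree hv
      · refine hr.eq_of_closure (fun G hG => hμ G hG.1) (fun G hG => hmem G hG.1 hG.2) ?_
          (q.mem_keyClosure_iff.1 hv).2
        rintro z (hz | hz)
        · exact hfree hz
        · exact hkey z hz
    obtain ⟨κ, hκR, hκ, hκX⟩ := exists_mix hR (key_subset_keyClosure hR) hS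
    refine ⟨κ, fun G hG => ?_, fun v hv => ?_, fun v hv => ?_⟩
    · by_cases hGR : G = R
      · rw [hGR, hκR]
        exact hμ R hR
      · rcases hκ G hG with h | h
        · exact h ▸ hμ G hG
        · exact h ▸ hmem G hG hGR
    · rw [hκX v fun h => h.mem_bound.2 hv]
      exact hνc hv
    · rw [hκX v fun h => hX v hv (attacksVar_iff.2 h)]
      exact hνd hv
  · refine ⟨ν, fun G hG => ?_, hνc, hνd⟩
    by_cases hGR : G = R
    · subst hGR
      have := hν G hG
      rw [Finset.mem_insert] at this
      exact Finset.mem_of_mem_erase (this.resolve_left hRB)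
    · exact hmem G hG hGR

-- While some embedding in `r` uses a fact outside `s`, exchange that fact for the key-equal one in
-- `s`: no answer is created and `r \ s` shrinks. When this stops, every embedding compatible with
-- `c` already lies in `s`.
open Classical in
theorem exists_repair_answer_inter (hq : q.SelfJoinFree) {X : Set V}
    (hX : ∀ v ∈ X, ∀ R ∈ q.body, ¬ q.AttacksVar R v) (c : V → C) {db s : Database σ C}
    (hs : db.IsRepair s) (n : ℕ) {r : Database σ C} (hr : db.IsRepair r) (hn : (r \ s).card = n) :
    ∃ t, db.IsRepair t ∧ ∀ d, q.Answer X t c d → q.Answer X r c d ∧ q.Answer X s c d := by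
  induction n using Nat.strong_induction_on generalizing r with
  | _ n ih =>
    by_cases hex : ∃ μ, q.Embeds r μ ∧ Set.EqOn μ c q.free ∧ ∃ R ∈ q.body, R.inst μ ∉ s
    · obtain ⟨μ, hμ, hμc, R, hR, hRs⟩ := hex
      obtain ⟨B, hB, hAB⟩ := hs.exists_keyEqual (hr.subset (hμ R hR))
      have hlt : (insert B (r.erase (R.inst μ)) \ s).card < n := by
        rw [← hn]
        refine Finset.card_lt_card (Finset.ssubset_iff.2 ⟨R.inst μ, ?_, ?_⟩)
        · simp only [Finset.mem_sdiff, Finset.mem_insert, Finset.mem_erase]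
          rintro ⟨h | h, -⟩
          · exact hRs (h ▸ hB)
          · exact h.1 rfl
        · refine Finset.insert_subset (Finset.mem_sdiff.2 ⟨hμ R hR, hRs⟩) fun A hA => ?_
          simp only [Finset.mem_sdiff, Finset.mem_insert, Finset.mem_erase] at hA ⊢
          rcases hA with ⟨h | h, hA⟩
          · exact absurd (h ▸ hB) hA
          · exact ⟨h.2, hA⟩
      obtain ⟨t, ht, htd⟩ := ih _ hlt (hr.swap (hμ R hR) (hs.subset hB) hAB) rfl
      exact ⟨t, ht, fun d hd => ⟨answer_of_answer_swap hq hR (fun v hv => hX v hv R hR)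
        hr.consistent hμ hμc hAB (htd d hd).1, (htd d hd).2⟩⟩
    · push Not at hex
      exact ⟨r, hr, fun d hd => ⟨hd, hd.imp fun μ h => ⟨hex μ h.1 h.2.1, h.2⟩⟩⟩

/-- On unattacked variables, some repair has the consistent answers only. -/
theorem exists_repair_forall_answer (hq : q.SelfJoinFree) {X : Set V}
    (hX : ∀ v ∈ X, ∀ R ∈ q.body, ¬ q.AttacksVar R v) (c : V → C) (db : Database σ C) :
    ∃ t, db.IsRepair t ∧ ∀ d, q.Answer X t c d → ∀ s, db.IsRepair s → q.Answer X s c d := by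
  classical
  have key : ∀ T : Finset (Database σ C), (∀ s ∈ T, db.IsRepair s) →
      ∃ t, db.IsRepair t ∧ ∀ d, q.Answer X t c d → ∀ s ∈ T, q.Answer X s c d := by
    intro T
    induction T using Finset.induction_on with
    | empty =>
      obtain ⟨t, ht⟩ := db.exists_repair
      exact fun _ => ⟨t, ht, by simp⟩
    | insert s T _ ih =>
      intro hT
      obtain ⟨t, ht, htd⟩ := ih fun s hs => hT s (Finset.mem_insert_of_mem hs)
      obtain ⟨t', ht', htd'⟩ := exists_repair_answer_inter hq hX c
        (hT s (Finset.mem_insert_self s T)) _ ht rfl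
      refine ⟨t', ht', fun d hd u hu => ?_⟩
      rcases Finset.mem_insert.1 hu with rfl | hu
      · exact (htd' d hd).2
      · exact htd d (htd' d hd).1 u hu
  obtain ⟨t, ht, h⟩ := key (db.powerset.filter db.IsRepair) fun s hs => (Finset.mem_filter.1 hs).2
  exact ⟨t, ht, fun d hd s hs => h d hd s
    (Finset.mem_filter.2 ⟨Finset.mem_powerset.2 hs.subset, hs⟩)⟩

/-- An embedding of a self-join-free query maps its atoms to a consistent set of facts. -/
theorem Embeds.exists_repair (hq : q.SelfJoinFree) {db : Database σ C} {μ : V → C}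
    (h : q.Embeds db μ) : ∃ r, db.IsRepair r ∧ q.Embeds r μ := by
  classical
  have hfin : ((fun F : QAtom σ V C => F.inst μ) '' q.body).Finite := q.finite_body.image _
  obtain ⟨r, hr, hsr⟩ := Database.exists_repair_superset (db := db) (s := hfin.toFinset)
    (by
      intro A hA
      obtain ⟨F, hF, rfl⟩ := hfin.mem_toFinset.1 hA
      exact h F hF)
    (by
      intro A hA B hB hAB
      obtain ⟨F, hF, rfl⟩ := hfin.mem_toFinset.1 hA
      obtain ⟨G, hG, rfl⟩ := hfin.mem_toFinset.1 hB
      rw [hq.eq_of_keyEqual hF hG hAB])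
  exact ⟨r, hr, fun F hF => hsr (hfin.mem_toFinset.2 ⟨F, hF, rfl⟩)⟩

end ConjQuery

/-! ### Closure properties of first-order definability -/

open FirstOrder in
/-- The property `P` of databases and valuations is defined by a first-order formula. -/
def FODefinable {σ : Schema} {C α : Type*} (P : Database σ C → (α → C) → Prop) : Prop :=
  ∃ φ : (σ.language[[C]]).Formula α, ∀ (db : Database σ C) (c : α → C),
    letI : σ.language.Structure C := db.toStructure
    φ.Realize c ↔ P db c

namespace FODefinable

open FirstOrder Language

variable {σ : Schema} {C α β : Type*}

theorem congr {P Q : Database σ C → (α → C) → Prop} (h : FODefinable P)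
    (hPQ : ∀ db c, P db c ↔ Q db c) : FODefinable Q := by
  obtain ⟨φ, hφ⟩ := h
  exact ⟨φ, fun db c => (hφ db c).trans (hPQ db c)⟩

theorem and {P Q : Database σ C → (α → C) → Prop} (hP : FODefinable P) (hQ : FODefinable Q) :
    FODefinable fun db c => P db c ∧ Q db c := by
  obtain ⟨φ, hφ⟩ := hP
  obtain ⟨ψ, hψ⟩ := hQ
  refine ⟨φ ⊓ ψ, fun db c => ?_⟩
  let := db.toStructure
  exact Formula.realize_inf.trans (and_congr (hφ db c) (hψ db c))

theorem imp {P Q : Database σ C → (α → C) → Prop} (hP : FODefinable P) (hQ : FODefinable Q) :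
    FODefinable fun db c => P db c → Q db c := by
  obtain ⟨φ, hφ⟩ := hP
  obtain ⟨ψ, hψ⟩ := hQ
  refine ⟨φ.imp ψ, fun db c => ?_⟩
  let := db.toStructure
  exact Formula.realize_imp.trans (imp_congr (hφ db c) (hψ db c))

theorem const_true : FODefinable fun (_ : Database σ C) (_ : α → C) => True :=
  ⟨⊤, fun _ _ => by simp [Formula.Realize]⟩

theorem subst {P : Database σ C → (α → C) → Prop} (hP : FODefinable P) (g : α → β ⊕ C) :
    FODefinable fun db (c : β → C) => P db fun a => Sum.elim c id (g a) := by
  obtain ⟨φ, hφ⟩ := hP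
  let t : α → (σ.language[[C]]).Term β := fun a =>
    Sum.elim Term.var (fun d => ((σ.language.con d).term : (σ.language[[C]]).Term β)) (g a)
  refine ⟨BoundedFormula.subst φ t, fun db c => ?_⟩
  let := db.toStructure
  have : (fun a => (t a).realize c) = fun a => Sum.elim c id (g a) := by
    funext a
    cases h : g a with
    | inl b => simp [t, h]
    | inr d =>
      simp only [t, h, Sum.elim_inr, Term.realize_constants]
      rfl
  rw [Formula.Realize, BoundedFormula.realize_subst, this]
  exact hφ db _

theorem relabel {P : Database σ C → (α → C) → Prop} (hP : FODefinable P) (g : α → β) :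
    FODefinable fun db (c : β → C) => P db (c ∘ g) :=
  hP.subst fun a => .inl (g a)

theorem eq_term (s t : α ⊕ C) :
    FODefinable fun (_ : Database σ C) (c : α → C) => Sum.elim c id s = Sum.elim c id t := by
  have h : FODefinable fun (_ : Database σ C) (c : Bool → C) => c true = c false :=
    ⟨(Term.var true : (σ.language[[C]]).Term Bool).equal (Term.var false), fun _ _ => by simp⟩
  exact (h.subst fun i => if i then s else t).congr fun _ _ => by simp

theorem mem (R : σ.Rel) (g : Fin (σ.arity R) → α) :
    FODefinable fun (db : Database σ C) (c : α → C) =>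
      (⟨R, fun i => c (g i)⟩ : DBFact σ C) ∈ db := by
  let R' : σ.language.Relations (σ.arity R) := ⟨R, rfl⟩
  refine ⟨Relations.formula (Sum.inl R' : (σ.language[[C]]).Relations (σ.arity R))
    fun i => Term.var (g i), fun db c => ?_⟩
  let := db.toStructure
  exact Formula.realize_rel.trans Iff.rfl

theorem all_finite {ι : Type*} [Finite ι] {P : ι → Database σ C → (α → C) → Prop}
    (hP : ∀ i, FODefinable (P i)) : FODefinable fun db c => ∀ i, P i db c := by
  classical
  have := Fintype.ofFinite ι
  have key : ∀ s : Finset ι, FODefinable fun db c => ∀ i ∈ s, P i db c := by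
    intro s
    induction s using Finset.induction_on with
    | empty => exact const_true.congr fun _ _ => by simp
    | insert a s _ ih => exact ((hP a).and ih).congr fun _ _ => by simp
  exact (key Finset.univ).congr fun _ _ => by simp

theorem exists_tuple [Finite β] {P : Database σ C → (α ⊕ β → C) → Prop} (hP : FODefinable P) :
    FODefinable fun db (c : α → C) => ∃ b : β → C, P db (Sum.elim c b) := by
  obtain ⟨φ, hφ⟩ := hP
  refine ⟨φ.iExs β, fun db c => ?_⟩
  let := db.toStructure
  rw [Formula.realize_iExs]
  exact exists_congr fun b => hφ db _

theorem forall_tuple [Finite β] {P : Database σ C → (α ⊕ β → C) → Prop} (hP : FODefinable P) :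
    FODefinable fun db (c : α → C) => ∀ b : β → C, P db (Sum.elim c b) := by
  obtain ⟨φ, hφ⟩ := hP
  refine ⟨φ.iAlls β, fun db c => ?_⟩
  let := db.toStructure
  rw [Formula.realize_iAlls]
  exact forall_congr' fun b => hφ db _

end FODefinable

/-! ### Rewriting queries with an acyclic attack graph -/

namespace ConjQuery

variable {σ : Schema} {V C : Type*} {q : ConjQuery σ V C}

theorem Reach.mono {q' : ConjQuery σ V C} (hbody : q'.body ⊆ q.body) (hbound : q'.bound ⊆ q.bound)
    {F : QAtom σ V C} {S S' : Set V} (hS : ∀ v ∈ q'.bound, v ∈ S → v ∈ S') {x : V}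
    (h : q'.Reach F S' x) : q.Reach F S x := by
  induction h with
  | base h1 h2 h3 => exact .base h1 (hbound h2) fun h => h3 (hS _ h2 h)
  | step _ h2 h3 h4 ih =>
    exact .step ih (h2.imp fun _ h => ⟨hbody h.1, h.2⟩) (hbound h3) fun h => h4 (hS _ h3 h)

/-- Fewer atoms, fewer bound variables and larger key closures leave fewer attacks. -/
theorem AttackAcyclic.mono {q' : ConjQuery σ V C} (hbody : q'.body ⊆ q.body)
    (hbound : q'.bound ⊆ q.bound)
    (hS : ∀ F ∈ q'.body, ∀ v ∈ q'.bound, v ∈ q.keyClosure F → v ∈ q'.keyClosure F)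
    (h : q.AttackAcyclic) : q'.AttackAcyclic := by
  intro F hF
  refine h ⟨F, hbody F.2⟩ (Relation.TransGen.lift (r := q'.Attacks) (p := q.Attacks)
    (fun G => ⟨G, hbody G.2⟩) ?_ F F hF)
  rintro G H ⟨hne, x, hx, hG⟩
  refine ⟨fun h => hne (Subtype.ext (Subtype.mk.inj h)), x, hx, ?_⟩
  exact attacksVar_iff.2 ((attacksVar_iff.1 hG).mono hbody hbound (hS G G.2))

theorem AttackAcyclic.makeFree (h : q.AttackAcyclic) (x : Set V) (hx : x ⊆ q.bound) :
    (q.makeFree x hx).AttackAcyclic := by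
  refine AttackAcyclic.mono (q := q) (q' := q.makeFree x hx) subset_rfl ?_ ?_ h
  · exact fun v hv => ⟨hv.1, fun h => hv.2 (.inl h)⟩
  · intro F _ v hv hvF
    refine (mem_keyClosure_iff _).2 ⟨hv.1, (q.mem_keyClosure_iff.1 hvF).2.mono subset_rfl ?_⟩
    exact Set.union_subset_union_left _ Set.subset_union_left

variable (q) in
/-- The query obtained by removing the atom `F` and making its variables free. -/
def residual (F : QAtom σ V C) : ConjQuery σ V C where
  body := q.body \ {F}
  finite_body := q.finite_body.subset Set.sdiff_subset
  free := (q.free ∪ F.vars) ∩ {v | ∃ G ∈ q.body \ {F}, v ∈ G.vars}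
  free_subset := Set.inter_subset_right

theorem AttackAcyclic.residual (h : q.AttackAcyclic) (F : QAtom σ V C) :
    (q.residual F).AttackAcyclic := by
  have hbound : ∀ v ∈ (q.residual F).bound, v ∉ q.free ∪ F.vars := fun v hv h => hv.2 ⟨h, hv.1⟩
  refine AttackAcyclic.mono (q := q) Set.sdiff_subset ?_ ?_ h
  · exact fun v hv => ⟨hv.1.imp fun G hG => ⟨hG.1.1, hG.2⟩, fun h => hbound v hv (.inl h)⟩
  · intro G _ v hv hvG
    have key : v ∈ q.free ∪ F.vars ∨
        AtomClosure ((q.residual F).body \ {G}) ((q.residual F).free ∪ G.key) v := by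
      have hc := (q.mem_keyClosure_iff.1 hvG).2
      clear hvG hv
      induction hc with
      | base h => exact h.imp .inl fun h => .base (.inr h)
      | @step v E hE _ hv ih =>
        by_cases hEF : E = F
        · exact .inl (.inr (hEF ▸ hv))
        · refine .inr (.step (F := E) ⟨⟨hE.1, hEF⟩, hE.2⟩ (fun u hu => ?_) hv)
          rcases ih u hu with h | h
          · exact .base (.inl ⟨h, E, ⟨hE.1, hEF⟩, E.key_subset_vars hu⟩)
          · exact h
    exact (mem_keyClosure_iff _).2 ⟨hv.1, key.resolve_left (hbound v hv)⟩

variable (q) in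
/-- Every repair satisfies the query, for the values of the free variables given by `c`. -/
def Certain (db : Database σ C) (c : V → C) : Prop :=
  ∀ r, db.IsRepair r → ∃ μ, q.Embeds r μ ∧ Set.EqOn μ c q.free

-- This eliminates one quantifier block of the rewriting. As `key F` is unattacked, its values in a
-- repair with fewest answers are answers in every repair. Putting any fact `b` of that block into
-- any repair then yields an embedding that uses `b`, and its other atoms, having other relation
-- names, map into the original repair. Conversely, every repair contains some fact of the block.
open Classical in
theorem certain_iff_of_unattacked (hq : q.SelfJoinFree) {F : QAtom σ V C} (hF : F ∈ q.body)
    (hu : ∀ v ∈ F.key, ∀ R ∈ q.body, ¬ q.AttacksVar R v) (db : Database σ C) (c : V → C) :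
    q.Certain db c ↔ ∃ a : Fin (σ.arity F.rel) → C, (⟨F.rel, a⟩ : DBFact σ C) ∈ db ∧
      ∀ b : Fin (σ.arity F.rel) → C, (⟨F.rel, b⟩ : DBFact σ C) ∈ db →
        (∀ i : Fin (σ.arity F.rel), (i : ℕ) < σ.keyLen F.rel → a i = b i) →
        ∃ d : V → C, Set.EqOn d c (F.vars \ q.free)ᶜ ∧
          (∀ i, b i = Sum.elim d id (F.args i)) ∧ (q.residual F).Certain db d := by
  constructor
  · intro h
    obtain ⟨t, ht, htd⟩ := exists_repair_forall_answer hq hu c db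
    obtain ⟨μ, hμ, hμc⟩ := h t ht
    have hall := htd μ ⟨μ, hμ, hμc, fun _ _ => rfl⟩
    refine ⟨(F.inst μ).args, ht.subset (hμ F hF), fun b hb hab => ?_⟩
    have hkey : (F.inst μ).KeyEqual ⟨F.rel, b⟩ := ⟨rfl, hab⟩
    have key : ∀ r, db.IsRepair r → ∃ ν, F.inst ν = ⟨F.rel, b⟩ ∧
        (∀ G ∈ q.body \ {F}, G.inst ν ∈ r) ∧ Set.EqOn ν c q.free := by
      intro r hr
      obtain ⟨A, hA, hAb⟩ := hr.exists_keyEqual hb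
      have hr' := hr.swap hA hb hAb.symm
      obtain ⟨ν, hν, hνc, hνk⟩ := hall _ hr'
      refine ⟨ν, ?_, fun G hG => ?_, hνc⟩
      · refine hr'.consistent _ (hν F hF) _ (Finset.mem_insert_self _ _) ?_
        exact (RelAtom.inst_keyEqual_inst_iff.2 hνk).trans hkey
      · have := hν G hG.1
        rw [Finset.mem_insert] at this
        rcases this with h | h
        · have hrel : (G.inst ν).rel = F.rel := by rw [h]
          exact absurd (hq G hG.1 F hF hrel) hG.2
        · exact Finset.mem_of_mem_erase h
    obtain ⟨r₀, hr₀⟩ := db.exists_repair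
    obtain ⟨ν, hν, -, hνc⟩ := key r₀ hr₀
    let d : V → C := fun v => if v ∈ F.vars \ q.free then ν v else c v
    have hd : ∀ v ∈ F.vars, d v = ν v := by
      intro v hv
      by_cases hvf : v ∈ q.free
      · simp [d, hvf, hνc hvf]
      · simp [d, hv, hvf]
    refine ⟨d, fun v hv => if_neg hv, fun i => ?_, fun r hr => ?_⟩
    · have h1 : F.inst d = ⟨F.rel, b⟩ := (RelAtom.inst_eq_inst_iff.2 hd).trans hν
      simp only [RelAtom.inst, RelAtom.mk.injEq, heq_eq_eq, true_and] at h1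
      exact (congrFun h1 i).symm
    · obtain ⟨ν', hν', hr', hνc'⟩ := key r hr
      refine ⟨ν', hr', fun v hv => ?_⟩
      by_cases hvF : v ∈ F.vars
      · rw [hd v hvF]
        exact RelAtom.inst_eq_inst_iff.1 (hν'.trans hν.symm) v hvF
      · rw [hνc' (hv.1.resolve_right hvF)]
        simp [d, hvF]
  · rintro ⟨a, ha, hall⟩ r hr
    obtain ⟨⟨R, b⟩, hb, hR, hab⟩ := hr.exists_keyEqual ha
    dsimp only at hR
    subst hR
    obtain ⟨d, hdc, hbd, hd⟩ := hall b (hr.subset hb) hab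
    obtain ⟨μ, hμ, hμd⟩ := hd r hr
    -- The residual query constrains `μ` only on variables of the remaining atoms; elsewhere the
    -- value must come from `d`.
    let ν : V → C := fun v => if ∃ G ∈ q.body \ {F}, v ∈ G.vars then μ v else d v
    have hνd : ∀ v ∈ q.free ∪ F.vars, ν v = d v := by
      intro v hv
      by_cases h : ∃ G ∈ q.body \ {F}, v ∈ G.vars
      · simp only [ν, if_pos h]
        exact hμd ⟨hv, h⟩
      · simp only [ν, if_neg h]
    refine ⟨ν, fun G hG => ?_, fun v hv => ?_⟩
    · by_cases hGF : G = F
      · subst hGF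
        rw [RelAtom.inst_eq_inst_iff.2 fun v hv => hνd v (.inr hv)]
        have : G.inst d = ⟨G.rel, b⟩ := by
          simp only [RelAtom.inst, RelAtom.mk.injEq, heq_eq_eq, true_and]
          exact funext fun i => (hbd i).symm
        rwa [this]
      · have : G.inst ν = G.inst μ :=
          RelAtom.inst_eq_inst_iff.2 fun v hv => if_pos ⟨G, ⟨hG, hGF⟩, hv⟩
        rw [this]
        exact hμ G ⟨hG, hGF⟩
    · rw [hνd v (.inl hv)]
      exact hdc fun h => h.2 hv

open Classical in
theorem AttackAcyclic.foDefinable_certain (h : q.AttackAcyclic) (hq : q.SelfJoinFree) :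
    FODefinable fun db (c : V → C) => q.Certain db c := by
  induction hn : q.body.ncard using Nat.strong_induction_on generalizing q with
  | _ n ih =>
    rcases q.body.eq_empty_or_nonempty with hemp | ⟨H, hH⟩
    · refine FODefinable.const_true.congr fun db c => ⟨fun _ r _ => ?_, fun _ => trivial⟩
      exact ⟨c, fun F hF => absurd hF (by simp [hemp]), fun _ _ => rfl⟩
    obtain ⟨⟨F, hF⟩, hU, -⟩ := h.exists_unattacked ⟨H, hH⟩
    have hu : ∀ v ∈ F.key, ∀ R ∈ q.body, ¬ q.AttacksVar R v := by
      intro v hv R hR hRv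
      by_cases hRF : R = F
      · exact not_attacksVar_key (hRF ▸ hv) hRv
      · exact hU ⟨R, hR⟩ ⟨fun h => hRF (congrArg Subtype.val h), v, F.key_subset_vars hv, hRv⟩
    have ih' := ih _ (hn ▸ Set.ncard_sdiff_singleton_lt_of_mem hF q.finite_body)
      (h.residual F) (fun A hA B hB => hq A hA.1 B hB.1) rfl
    have : Finite ↥(F.vars \ q.free) := (F.finite_vars.subset Set.sdiff_subset).to_subtype
    let n := Fin (σ.arity F.rel)
    -- The bound variables of `F` are read from freshly quantified variables; all others keep their
    -- current value. The two copies of `n` hold the arguments `a` and `b`.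
    let g : V → ((V ⊕ n) ⊕ n) ⊕ ↥(F.vars \ q.free) := fun v =>
      if h : v ∈ F.vars \ q.free then .inr ⟨v, h⟩ else .inl (.inl (.inl v))
    have h1 := (FODefinable.all_finite fun i : n =>
      FODefinable.eq_term (σ := σ) (C := C) (.inl (.inl (.inr i))) (Sum.map g id (F.args i))).and
      (ih'.relabel g)
    have h2 := (FODefinable.mem F.rel fun i : n => (Sum.inr i : (V ⊕ n) ⊕ n)).imp
      ((FODefinable.all_finite fun i : {i : n // (i : ℕ) < σ.keyLen F.rel} =>
        FODefinable.eq_term (.inl (.inl (.inr i.1))) (.inl (.inr i.1))).imp h1.exists_tuple)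
    have h3 := (FODefinable.mem F.rel fun i : n => (Sum.inr i : V ⊕ n)).and h2.forall_tuple
    refine h3.exists_tuple.congr fun db c => ?_
    rw [certain_iff_of_unattacked hq hF hu]
    refine exists_congr fun a => and_congr Iff.rfl (forall_congr' fun b => imp_congr Iff.rfl
      (imp_congr ⟨fun h i hi => h ⟨i, hi⟩, fun h i => h i i.2⟩ ⟨?_, ?_⟩))
    · rintro ⟨w, hw, hc⟩
      refine ⟨_, fun v hv => ?_, fun i => ?_, hc⟩
      · have : g v = .inl (.inl (.inl v)) := dif_neg hv
        simp [this]
      · refine (hw i).trans ?_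
        cases F.args i <;> rfl
    · rintro ⟨d, hdc, hb, hd⟩
      have hdg : Sum.elim (Sum.elim (Sum.elim c a) b)
          (fun v : ↥(F.vars \ q.free) => d v) ∘ g = d := by
        funext v
        by_cases hv : v ∈ F.vars \ q.free
        · have : g v = .inr ⟨v, hv⟩ := dif_pos hv
          simp [this]
        · have : g v = .inl (.inl (.inl v)) := dif_neg hv
          simp [this, hdc hv]
      refine ⟨fun v => d v, fun i => (hb i).trans ?_, ?_⟩
      · conv_lhs => rw [← hdg]
        cases F.args i <;> rfl
      · rw [hdg]
        exact hd

open Classical in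
theorem AttackAcyclic.hasConsistentRewriting [Nonempty C] (h : q.AttackAcyclic)
    (hq : q.SelfJoinFree) : q.HasConsistentRewriting := by
  -- The constant plugged in for the non-free variables is immaterial, since `Certain` reads `c`
  -- only on `q.free`.
  let g : V → q.free ⊕ C := fun v =>
    if h : v ∈ q.free then .inl ⟨v, h⟩ else .inr (Classical.arbitrary C)
  obtain ⟨φ, hφ⟩ := (h.foDefinable_certain hq).subst g
  refine ⟨φ, fun db c => (hφ db c).trans (forall₂_congr fun r _ => exists_congr fun μ => ?_)⟩
  rw [and_comm]
  refine and_congr ⟨fun h v => (h v.2).trans ?_, fun h v hv => (h ⟨v, hv⟩).trans ?_⟩ Iff.rfl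
  · have : g v = .inl v := dif_pos v.2
    simp [this]
  · have : g v = .inl ⟨v, hv⟩ := dif_pos hv
    simp [this]

end ConjQuery

namespace ConjQuery

variable {σ : Schema} {V C : Type*} {q : ConjQuery σ V C}

/-! ### Counting answers -/

variable (q) in
/-- The tuples for `x` that, together with the values of `c` on the free variables, are answers. -/
def answerSet (x : Set V) (db : Database σ C) (c : V → C) : Set (x → C) :=
  (fun θ v => θ v) '' {θ : V → C | q.Embeds db θ ∧ Set.EqOn θ c q.free}

theorem sat_glue_iff {x : Set V} (hx : x ⊆ q.bound) (db : Database σ C) (c : V → C) (d : x → C) :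
    (q.makeFree x hx).Sat db (q.glue x hx (fun v => c v) d) ↔ d ∈ q.answerSet x db c := by
  constructor
  · rintro ⟨θ, hθ, h⟩
    refine ⟨θ, ⟨h, fun v hv => ?_⟩, funext fun v => ?_⟩
    · refine (hθ ⟨v, .inl hv⟩).trans ?_
      simp [glue, hv]
    · refine (hθ ⟨v, .inr v.2⟩).trans ?_
      simp [glue, (hx v.2).2]
  · rintro ⟨θ, ⟨h, hc⟩, rfl⟩
    refine ⟨θ, fun v => ?_, h⟩
    by_cases hv : (v : V) ∈ q.free
    · simp only [glue, hv, dif_pos]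
      exact hc hv
    · simp only [glue, hv, dif_neg, not_false_eq_true]

theorem certainSat_glue_iff {x : Set V} (hx : x ⊆ q.bound) (db : Database σ C) (c : V → C)
    (d : x → C) : (q.makeFree x hx).CertainSat db (q.glue x hx (fun v => c v) d) ↔
      ∀ r, db.IsRepair r → d ∈ q.answerSet x r c :=
  forall₂_congr fun r _ => sat_glue_iff hx r c d

theorem countReturns_iff {r : Database σ C} {c : V → C} {i : ℕ} :
    q.CountReturns r (fun v => c v) i ↔ 1 ≤ i ∧ i = (q.answerSet q.bound r c).ncard := by
  simp only [CountReturns, sat_glue_iff, Set.ofPred_mem_eq]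

theorem answerSet_mono {x : Set V} {db db' : Database σ C} (h : db ⊆ db') (c : V → C) :
    q.answerSet x db c ⊆ q.answerSet x db' c :=
  Set.image_mono fun _ hθ => ⟨hθ.1.mono h, hθ.2⟩

theorem finite_answerSet {x : Set V} (hx : x ⊆ q.vars) (db : Database σ C) (c : V → C) :
    (q.answerSet x db c).Finite := by
  have hfin : (⋃ A ∈ db, Set.range A.args).Finite :=
    db.finite_toSet.biUnion fun A _ => Set.finite_range A.args
  have : Finite x := (q.finite_vars.subset hx).to_subtype
  refine (Set.Finite.pi' (t := fun _ : x => ⋃ A ∈ db, Set.range A.args) fun _ => hfin).subset ?_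
  rintro _ ⟨θ, ⟨hθ, -⟩, rfl⟩ v
  obtain ⟨F, hF, i, hi⟩ := hx v.2
  exact Set.mem_biUnion (hθ F hF) ⟨i, by simp [RelAtom.inst, hi]⟩

theorem answerSet_eq_image {x y : Set V} (hxy : x ⊆ y) (db : Database σ C) (c : V → C) :
    q.answerSet x db c = (fun d (v : x) => d ⟨v, hxy v.2⟩) '' q.answerSet y db c := by
  simp only [answerSet, Set.image_image]

/-- On consistent databases, answers are determined by variables that determine the whole query. -/
theorem ncard_answerSet_bound {x : Set V} (hx : x ⊆ q.bound)
    (hK : ∀ v ∈ q.vars, AtomClosure q.body (q.free ∪ x) v) {r : Database σ C} (hr : r.Consistent)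
    (c : V → C) : (q.answerSet q.bound r c).ncard = (q.answerSet x r c).ncard := by
  rw [answerSet_eq_image hx, Set.InjOn.ncard_image]
  rintro _ ⟨μ, ⟨hμ, hμc⟩, rfl⟩ _ ⟨ν, ⟨hν, hνc⟩, rfl⟩ h
  funext v
  refine hr.eq_of_closure hμ hν ?_ (hK v v.2.1)
  rintro z (hz | hz)
  · exact (hμc hz).trans (hνc hz).symm
  · exact congrFun h ⟨z, hz⟩

theorem certain_of_forall_mem {x : Set V} {db : Database σ C} {c : V → C} {d : x → C}
    (h : ∀ r, db.IsRepair r → d ∈ q.answerSet x r c) : q.Certain db c := by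
  intro r hr
  obtain ⟨θ, hθ, -⟩ := h r hr
  exact ⟨θ, hθ⟩

theorem Certain.one_le_ncard {x : Set V} (hx : x ⊆ q.vars) {db : Database σ C} {c : V → C}
    (h : q.Certain db c) {r : Database σ C} (hr : db.IsRepair r) :
    1 ≤ (q.answerSet x r c).ncard := by
  obtain ⟨θ, hθ⟩ := h r hr
  exact (Set.ncard_pos (finite_answerSet hx r c)).2 ⟨_, θ, hθ, rfl⟩

theorem certain_of_rangeReturns {db : Database σ C} {c : V → C} {m n : ℕ}
    (h : q.RangeReturns db (fun v => c v) m n) : q.Certain db c := by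
  intro r hr
  obtain ⟨i, hi, -⟩ := h.1 r hr
  rw [countReturns_iff] at hi
  obtain ⟨_, θ, hθ, -⟩ := Set.nonempty_of_ncard_ne_zero (hi.2 ▸ Nat.one_le_iff_ne_zero.1 hi.1)
  exact ⟨θ, hθ⟩

theorem exists_eq_restrict [Nonempty C] (s : Set V) (c : s → C) :
    ∃ c' : V → C, c = fun v : s => c' v := by
  classical
  exact ⟨fun v => if h : v ∈ s then c ⟨v, h⟩ else Classical.arbitrary C, funext fun v => by simp⟩

/-! ### Sufficiency -/

theorem Reach.exists_walk {R : QAtom σ V C} {S : Set V} {w : V} (h : q.Reach R S w) :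
    ∃ (u v : q.bound) (p : q.queryGraph.Walk u v), (u : V) ∈ R.notKey ∧ (v : V) = w ∧
      ∀ z ∈ p.support, (z : V) ∉ S := by
  induction h with
  | @base u h1 h2 h3 => exact ⟨⟨u, h2⟩, ⟨u, h2⟩, .nil, h1, rfl, by simpa using h3⟩
  | @step u v h1 h2 h3 h4 ih =>
    obtain ⟨a, b, p, ha, rfl, hp⟩ := ih
    -- `OccurTogether` relates a variable to itself, whereas the query graph has no loops.
    by_cases hbv : (b : V) = v
    · exact ⟨a, b, p, ha, hbv, hp⟩
    · have hadj : q.queryGraph.Adj b ⟨v, h3⟩ := ⟨fun h => hbv (congrArg Subtype.val h), h2⟩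
      refine ⟨a, ⟨v, h3⟩, p.concat hadj, ha, rfl, fun z hz => ?_⟩
      rw [SimpleGraph.Walk.support_concat, List.mem_append, List.mem_singleton] at hz
      rcases hz with hz | rfl
      · exact hp z hz
      · exact h4

theorem SeparationCondition.not_reach {x : Set V} (h : q.SeparationCondition x)
    {R : QAtom σ V C} (hR : R ∈ q.body) {v : V} (hv : v ∈ x) :
    ¬ q.Reach R (R.key ∪ q.frozen) v := by
  intro hr
  obtain ⟨u, v, p, hu, rfl, hp⟩ := hr.exists_walk
  obtain ⟨w, hw, hw'⟩ := h R hR u v hu hv p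
  exact hp w hw hw'

/-- Key variables of `R` and frozen variables are never attacked by `R`, so an attack witness ending
in `x` would be a path forbidden by separation. -/
theorem SeparationCondition.not_attacksVar {x : Set V} (h : q.SeparationCondition x)
    {R : QAtom σ V C} (hR : R ∈ q.body) {v : V} (hv : v ∈ x) : ¬ q.AttacksVar R v := by
  intro hatt
  have : ∀ w, q.Reach R (q.keyClosure R) w → q.Reach R (R.key ∪ q.frozen) w := by
    have haux : ∀ w, q.Reach R (q.keyClosure R) w → w ∉ R.key ∪ q.frozen := by
      rintro w hw (hk | hf)
      · exact not_attacksVar_key hk (attacksVar_iff.2 hw)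
      · exact not_attacksVar_frozen hf R (attacksVar_iff.2 hw)
    intro w hw
    induction hw with
    | base h1 h2 h3 => exact .base h1 h2 (haux _ (.base h1 h2 h3))
    | step h1 h2 h3 h4 ih => exact .step ih h2 h3 (haux _ (.step h1 h2 h3 h4))
  exact h.not_reach hR hv (this v (attacksVar_iff.1 hatt))

/-- Being below an unattacked atom whose key `x` determines (`P`) spreads along the edges of the
weak attack graph: downwards by transitivity, upwards because two unattacked atoms attacking a
common atom determine each other's keys. Weakness of attacks then passes from the key of `U` to that
of `H`. -/
theorem SourceCondition.closure_of_mem_vars {x : Set V} (hx : q.SourceCondition x)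
    (hac : q.AttackAcyclic) (hstrong : ∀ F G : q.body, ¬ q.StrongAttacks F G) :
    ∀ v ∈ q.vars, AtomClosure q.body (q.free ∪ x) v := by
  have hweak : ∀ U H : q.body, (U = H ∨ q.Attacks U H) →
      (∀ k ∈ (U : QAtom σ V C).key, AtomClosure q.body (q.free ∪ x) k) →
      ∀ k ∈ (H : QAtom σ V C).key, AtomClosure q.body (q.free ∪ x) k := by
    rintro U H (rfl | hUH) hU
    · exact hU
    · intro k hk
      have := not_and_not_right.1 (hstrong U H) hUH
      refine ((q.fdImplies_fdSet_iff _ _).1 this k hk).trans subset_rfl ?_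
      rintro z (hz | hz)
      · exact .base (.inl hz)
      · exact hU z hz
  have hover : ∀ U U' H : q.body, q.Unattacked U → q.Unattacked U' →
      (U = H ∨ q.Attacks U H) → (U' = H ∨ q.Attacks U' H) →
      (∀ k ∈ (U : QAtom σ V C).key, AtomClosure q.body (q.free ∪ x) k) →
      ∀ k ∈ (U' : QAtom σ V C).key, AtomClosure q.body (q.free ∪ x) k := by
    rintro U U' H hU hU' (rfl | h) (rfl | h') hk
    · exact hk
    · exact absurd h' (hU U')
    · exact absurd h (hU' U)
    · intro k hk'
      refine (closure_key_of_attacks h h' (hU' U) (hU U') k hk').trans subset_rfl ?_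
      rintro z (hz | hz)
      · exact .base (.inl hz)
      · exact hk z hz
  have hup : ∀ U G H : q.body, q.Unattacked U → (U = G ∨ q.Attacks U G) → q.Attacks G H →
      (U = H ∨ q.Attacks U H) := by
    rintro U G H hU (rfl | h) hGH
    · exact .inr hGH
    · exact .inr (h.trans hGH (hU G))
  let P : q.body → Prop := fun H => ∃ U, q.Unattacked U ∧ (U = H ∨ q.Attacks U H) ∧
    ∀ k ∈ (U : QAtom σ V C).key, AtomClosure q.body (q.free ∪ x) k
  have hadj : ∀ G H : q.body, q.weakAttackGraph.Adj G H → P G → P H := by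
    rintro G H h ⟨U, hU, hUG, hk⟩
    rw [weakAttackGraph, SimpleGraph.fromRel_adj] at h
    rcases h.2 with hGH | hHG
    · exact ⟨U, hU, hup U G H hU hUG hGH, hk⟩
    · obtain ⟨W, hW, hWH⟩ := hac.exists_unattacked H
      exact ⟨W, hW, hWH, hover U W G hU hW hUG (hup W H G hW hWH hHG) hk⟩
  have hwalk : ∀ G H : q.body, q.weakAttackGraph.Walk G H → P G → P H := by
    intro G H p
    induction p with
    | nil => exact id
    | cons h _ ih => exact fun hP => ih (hadj _ _ h hP)
  rintro v ⟨H, hH, hv⟩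
  obtain ⟨R, hR, hRu, hRk⟩ := hx (q.weakAttackGraph.connectedComponentMk ⟨H, hH⟩)
  rw [SimpleGraph.ConnectedComponent.mem_supp_iff, SimpleGraph.ConnectedComponent.eq] at hR
  obtain ⟨p⟩ := hR
  obtain ⟨U, -, hUH, hk⟩ :=
    hwalk _ _ p ⟨R, hRu, .inl rfl, (q.fdImplies_fdSet_iff _ _).1 hRk⟩
  exact .step hH (hweak U ⟨H, hH⟩ hUH hk) hv

/-- If the query is certain, then frozen variables have the same value in all embeddings. -/
theorem Certain.eqOn_frozen (hq : q.SelfJoinFree) {db : Database σ C} {c : V → C}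
    (h : q.Certain db c) {μ ν : V → C} (hμ : q.Embeds db μ) (hμc : Set.EqOn μ c q.free)
    (hν : q.Embeds db ν) (hνc : Set.EqOn ν c q.free) : Set.EqOn μ ν q.frozen := by
  obtain ⟨t, ht, htd⟩ := exists_repair_forall_answer hq
    (fun v hv R _ => not_attacksVar_frozen (q := q) hv R) c db
  obtain ⟨θ, hθ, hθc⟩ := h t ht
  have hall := htd θ ⟨θ, hθ, hθc, fun _ _ => rfl⟩
  have key : ∀ μ, q.Embeds db μ → Set.EqOn μ c q.free → Set.EqOn μ θ q.frozen := by
    intro μ hμ hμc v hv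
    -- A repair containing the image of `μ` also has an embedding with the frozen values of `θ`.
    -- Frozen variables are derivable from the free ones, so the two agree there.
    obtain ⟨r, hr, hμr⟩ := hμ.exists_repair hq
    obtain ⟨κ, hκ, hκc, hκθ⟩ := hall r hr
    rw [← hκθ hv]
    exact hr.consistent.eq_of_closure hμr hκ (fun z hz => (hμc hz).trans (hκc hz).symm)
      (frozen_closure hv)
  exact fun v hv => (key μ hμ hμc hv).trans (key ν hν hνc hv).symm

open Classical in
/-- An embedding can be added to a consistent set of facts without losing answers. -/
theorem exists_insert_embedding (hq : q.SelfJoinFree) {x : Set V}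
    (hsep : ∀ R ∈ q.body, ∀ v ∈ x, ¬ q.Reach R (R.key ∪ q.frozen) v) {db : Database σ C}
    {c : V → C} (hfr : ∀ μ ν, q.Embeds db μ → Set.EqOn μ c q.free → q.Embeds db ν →
      Set.EqOn ν c q.free → Set.EqOn μ ν q.frozen)
    {r : Database σ C} (hr : r ⊆ db) (hrc : r.Consistent) {θ : V → C} (hθ : q.Embeds db θ)
    (hθc : Set.EqOn θ c q.free) :
    ∃ r' ⊆ db, r'.Consistent ∧ q.Embeds r' θ ∧ q.answerSet x r c ⊆ q.answerSet x r' c := by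
  have hfin : ((fun F : QAtom σ V C => F.inst θ) '' q.body).Finite := q.finite_body.image _
  -- The facts of `θ` are added, and the facts of `r` key-equal to one of them are dropped.
  let r' : Database σ C :=
    (r.filter fun A => ∀ G ∈ q.body, ¬ (G.inst θ).KeyEqual A) ∪ hfin.toFinset
  have hmem : ∀ A, A ∈ r' ↔ (A ∈ r ∧ ∀ G ∈ q.body, ¬ (G.inst θ).KeyEqual A) ∨
      ∃ G ∈ q.body, G.inst θ = A := by
    intro A
    simp [r']
  -- Induction on the number of atoms on which `κ` differs from `θ`: at a conflict, mixing moves `R`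
  -- over to the fact of `θ` and leaves `x` unchanged.
  have key : ∀ n, ∀ κ : V → C, (∀ G ∈ q.body, G.inst κ ∈ r ∨ G.inst κ = G.inst θ) →
      Set.EqOn κ c q.free → {G ∈ q.body | G.inst κ ≠ G.inst θ}.ncard = n →
      ∃ κ', q.Embeds r' κ' ∧ Set.EqOn κ' c q.free ∧ Set.EqOn κ' κ x := by
    intro n
    induction n using Nat.strong_induction_on with
    | _ n ih =>
      intro κ hκ hκc hn
      by_cases hex : ∃ R ∈ q.body, R.inst κ ≠ R.inst θ ∧ (R.inst θ).KeyEqual (R.inst κ)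
      · obtain ⟨R, hR, hne, hkey⟩ := hex
        have hκdb : q.Embeds db κ := fun G hG => (hκ G hG).elim (fun h => hr h) fun h => h ▸ hθ G hG
        obtain ⟨κ', hκR, hκ', hκx⟩ := exists_mix (S := R.key ∪ q.frozen) hR
          Set.subset_union_left (μ := θ) (ν := κ) (by
            rintro v - (hv | hv | hv)
            · exact (hθc hv).trans (hκc hv).symm
            · exact RelAtom.inst_keyEqual_inst_iff.1 hkey v hv
            · exact hfr θ κ hθ hθc hκdb hκc hv)
        have hlt : {G ∈ q.body | G.inst κ' ≠ G.inst θ}.ncard < n := by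
          rw [← hn]
          refine Set.ncard_lt_ncard (Set.ssubset_iff_of_subset ?_ |>.2 ⟨R, ⟨hR, hne⟩, fun h =>
            h.2 hκR⟩) (q.finite_body.subset fun _ h => h.1)
          rintro G ⟨hG, hGne⟩
          refine ⟨hG, ?_⟩
          rwa [← (hκ' G hG).resolve_left hGne]
        obtain ⟨κ'', h1, h2, h3⟩ := ih _ hlt κ' (fun G hG => by
          rcases hκ' G hG with h | h
          · exact .inr h
          · rw [h]; exact hκ G hG)
          (fun v hv => (hκx v fun h => h.mem_bound.2 hv).trans (hκc hv)) rfl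
        exact ⟨κ'', h1, h2, fun v hv => (h3 hv).trans (hκx v (hsep R hR v hv))⟩
      · push Not at hex
        refine ⟨κ, fun G hG => (hmem _).2 ?_, hκc, fun _ _ => rfl⟩
        by_cases hGθ : G.inst κ = G.inst θ
        · exact .inr ⟨G, hG, hGθ.symm⟩
        · refine .inl ⟨(hκ G hG).resolve_right hGθ, fun G' hG' h => ?_⟩
          obtain rfl := hq.eq_of_keyEqual hG' hG h
          exact hex _ hG hGθ h
  refine ⟨r', fun A hA => ?_, ?_, fun G hG => (hmem _).2 (.inr ⟨G, hG, rfl⟩), ?_⟩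
  · rcases (hmem A).1 hA with h | ⟨G, hG, rfl⟩
    · exact hr h.1
    · exact hθ G hG
  · intro A hA B hB hAB
    rcases (hmem A).1 hA with h | ⟨G, hG, rfl⟩ <;> rcases (hmem B).1 hB with h' | ⟨G', hG', rfl⟩
    · exact hrc A h.1 B h'.1 hAB
    · exact absurd hAB.symm (h.2 G' hG')
    · exact absurd hAB (h'.2 G hG)
    · rw [hq.eq_of_keyEqual hG hG' hAB]
  · rintro _ ⟨μ, ⟨hμ, hμc⟩, rfl⟩
    obtain ⟨κ, h1, h2, h3⟩ := key _ μ (fun G hG => .inl (hμ G hG)) hμc rfl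
    exact ⟨κ, ⟨h1, h2⟩, funext fun v => h3 v.2⟩

/-- If the query is certain, then some repair has all the answers on an id-set. -/
theorem Certain.exists_repair_answerSet (hq : q.SelfJoinFree) {x : Set V} (hx : x ⊆ q.bound)
    (hsep : ∀ R ∈ q.body, ∀ v ∈ x, ¬ q.Reach R (R.key ∪ q.frozen) v) {db : Database σ C}
    {c : V → C} (h : q.Certain db c) :
    ∃ r, db.IsRepair r ∧ q.answerSet x db c ⊆ q.answerSet x r c := by
  have key : ∀ T : Set (x → C), T.Finite → T ⊆ q.answerSet x db c →
      ∃ r ⊆ db, r.Consistent ∧ T ⊆ q.answerSet x r c := by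
    intro T hT
    induction T, hT using Set.Finite.induction_on with
    | empty =>
      obtain ⟨r, hr⟩ := db.exists_repair
      exact fun _ => ⟨r, hr.subset, hr.consistent, Set.empty_subset _⟩
    | @insert d T _ _ ih =>
      intro hT
      obtain ⟨r, hr, hrc, hrT⟩ := ih ((Set.subset_insert d T).trans hT)
      obtain ⟨θ, ⟨hθ, hθc⟩, rfl⟩ := hT (Set.mem_insert d T)
      obtain ⟨r', hr', hrc', hθr, hsub⟩ := exists_insert_embedding hq hsep
        (fun μ ν h1 h2 h3 h4 => h.eqOn_frozen hq h1 h2 h3 h4) hr hrc hθ hθc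
      exact ⟨r', hr', hrc', Set.insert_subset ⟨θ, ⟨hθr, hθc⟩, rfl⟩ (hrT.trans hsub)⟩
  obtain ⟨r, hr, hrc, hsub⟩ := key _ (finite_answerSet (hx.trans Set.sdiff_subset) db c) subset_rfl
  obtain ⟨r', hr', hrr'⟩ := Database.exists_repair_superset hr hrc
  exact ⟨r', hr', hsub.trans (answerSet_mono hrr' c)⟩

theorem InCparsimony.admitsParsimoniousCounting [Nonempty C] (hq : q.SelfJoinFree)
    (h : q.InCparsimony) : q.AdmitsParsimoniousCounting := by
  obtain ⟨hac, hstrong, x, hx, hsource, hsep⟩ := h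
  have hxv : x ⊆ q.vars := hx.trans Set.sdiff_subset
  refine ⟨x, hx, hac.hasConsistentRewriting hq, (hac.makeFree x hx).hasConsistentRewriting hq, ?_⟩
  intro db c m n
  obtain ⟨c, rfl⟩ := exists_eq_restrict q.free c
  have hcount : ∀ r, db.IsRepair r →
      (q.answerSet q.bound r c).ncard = (q.answerSet x r c).ncard := fun r hr =>
    ncard_answerSet_bound hx (hsource.closure_of_mem_vars hac hstrong) hr.consistent c
  simp only [sat_glue_iff, certainSat_glue_iff, Set.ofPred_mem_eq]
  obtain ⟨t, ht, htmin⟩ := exists_repair_forall_answer hq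
    (fun v hv R hR => hsep.not_attacksVar hR hv) c db
  have hcert : {d : x → C | ∀ r, db.IsRepair r → d ∈ q.answerSet x r c} = q.answerSet x t c := by
    refine Set.Subset.antisymm (fun d hd => hd t ht) ?_
    rintro _ ⟨θ, ⟨hθ, hθc⟩, rfl⟩ r hr
    obtain ⟨ν, hν, hνc, hνθ⟩ := htmin θ ⟨θ, hθ, hθc, fun _ _ => rfl⟩ r hr
    exact ⟨ν, ⟨hν, hνc⟩, funext fun v => hνθ v.2⟩
  have hle : ∀ r, db.IsRepair r → (q.answerSet x t c).ncard ≤ (q.answerSet x r c).ncard := by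
    intro r hr
    refine Set.ncard_le_ncard ?_ (finite_answerSet hxv r c)
    rw [← hcert]
    exact fun d hd => hd r hr
  have hge : ∀ r, db.IsRepair r → (q.answerSet x r c).ncard ≤ (q.answerSet x db c).ncard :=
    fun r hr => Set.ncard_le_ncard (answerSet_mono hr.subset c) (finite_answerSet hxv db c)
  have hmax : q.Certain db c → ∃ r, db.IsRepair r ∧
      (q.answerSet x r c).ncard = (q.answerSet x db c).ncard := by
    intro hc
    obtain ⟨r, hr, hsub⟩ :=
      hc.exists_repair_answerSet hq hx (fun R hR v hv => hsep.not_reach hR hv)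
    exact ⟨r, hr, congrArg Set.ncard ((answerSet_mono hr.subset c).antisymm hsub)⟩
  rw [hcert]
  constructor
  · intro h
    obtain ⟨u, hu, hun⟩ := hmax (certain_of_rangeReturns h)
    obtain ⟨hall, ⟨r₁, hr₁, h₁⟩, ⟨r₂, hr₂, h₂⟩⟩ := h
    simp only [countReturns_iff] at hall h₁ h₂
    obtain ⟨i, ⟨-, hi⟩, hmi, -⟩ := hall t ht
    obtain ⟨j, ⟨-, hj⟩, -, hjn⟩ := hall u hu
    have := hcount t ht
    have := hcount u hu
    have := hcount r₁ hr₁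
    have := hcount r₂ hr₂
    have := hle r₁ hr₁
    have := hge r₂ hr₂
    omega
  · rintro ⟨hm, rfl, rfl⟩
    -- A positive lower bound supplies a consistent answer on `x`, which makes the query certain.
    have hc : q.Certain db c := by
      obtain ⟨d, hd⟩ := Set.nonempty_of_ncard_ne_zero (Nat.one_le_iff_ne_zero.1 hm)
      rw [← hcert] at hd
      exact certain_of_forall_mem hd
    obtain ⟨u, hu, hun⟩ := hmax hc
    simp only [RangeReturns, countReturns_iff]
    refine ⟨fun r hr => ⟨_, ⟨?_, rfl⟩, ?_, ?_⟩, ⟨t, ht, hm, (hcount t ht).symm⟩,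
      ⟨u, hu, ?_, ?_⟩⟩
    · exact hc.one_le_ncard Set.sdiff_subset hr
    · rw [hcount r hr]
      exact hle r hr
    · rw [hcount r hr]
      exact hge r hr
    · exact hm.trans (hun ▸ hle u hu)
    · rw [hcount u hu, hun]

end ConjQuery

namespace ConjQuery

variable {σ : Schema} {V C : Type*} {q : ConjQuery σ V C}

/-! ### Necessity -/

variable (q) in
/-- The consequences of parsimonious counting on `x` for certain queries. -/
def ParsimoniousCounts (x : Set V) : Prop :=
  ∀ (db : Database σ C) (c : V → C), q.Certain db c →
    (∃ d, ∀ r, db.IsRepair r → d ∈ q.answerSet x r c) ∧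
    ∃ r, db.IsRepair r ∧ (q.answerSet q.bound r c).ncard = (q.answerSet x db c).ncard

/-- For a certain query, the least and greatest counts over the finitely many repairs form a range,
to which condition (C) applies. -/
theorem AdmitsParsimoniousCountingOn.parsimoniousCounts {x : Set V} {hx : x ⊆ q.bound}
    (h : q.AdmitsParsimoniousCountingOn x hx) : q.ParsimoniousCounts x := by
  intro db c hc
  have hfin : {r | db.IsRepair r}.Finite :=
    db.powerset.finite_toSet.subset fun t ht => Finset.mem_coe.2 (Finset.mem_powerset.2 ht.subset)
  have hne : {r | db.IsRepair r}.Nonempty := db.exists_repair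
  obtain ⟨r₁, hr₁, h₁⟩ := Set.exists_min_image _ (fun r => (q.answerSet q.bound r c).ncard) hfin hne
  obtain ⟨r₂, hr₂, h₂⟩ := Set.exists_max_image _ (fun r => (q.answerSet q.bound r c).ncard) hfin hne
  have hone := fun r (hr : db.IsRepair r) => hc.one_le_ncard (x := q.bound) Set.sdiff_subset hr
  have hrange : q.RangeReturns db (fun v => c v) (q.answerSet q.bound r₁ c).ncard
      (q.answerSet q.bound r₂ c).ncard := by
    simp only [RangeReturns, countReturns_iff]
    exact ⟨fun r hr => ⟨_, ⟨hone r hr, rfl⟩, h₁ r hr, h₂ r hr⟩, ⟨r₁, hr₁, hone r₁ hr₁, rfl⟩,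
      ⟨r₂, hr₂, hone r₂ hr₂, rfl⟩⟩
  have := (h.2.2 db (fun v => c v) _ _).1 hrange
  simp only [sat_glue_iff, certainSat_glue_iff, Set.ofPred_mem_eq] at this
  obtain ⟨h1, h2, h3⟩ := this
  exact ⟨Set.nonempty_of_ncard_ne_zero (Nat.one_le_iff_ne_zero.1 (h2 ▸ h1)), r₂, hr₂, h3⟩

-- All counterexample databases below are such unions of copies of the body under finitely many
-- valuations.
variable (q) in
theorem exists_database {ι : Type*} [Finite ι] (θ : ι → V → C) :
    ∃ db : Database σ C, ∀ A, A ∈ db ↔ ∃ i, ∃ F ∈ q.body, F.inst (θ i) = A := by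
  have hfin : (⋃ i, (fun F : QAtom σ V C => F.inst (θ i)) '' q.body).Finite :=
    Set.finite_iUnion fun i => q.finite_body.image _
  exact ⟨hfin.toFinset, fun A => by simp⟩

section Family

variable {ι : Type*} {θ : ι → V → C} {db : Database σ C}

theorem embeds_of_mem_iff (hdb : ∀ A, A ∈ db ↔ ∃ i, ∃ F ∈ q.body, F.inst (θ i) = A) (i : ι) :
    q.Embeds db (θ i) :=
  fun F hF => (hdb _).2 ⟨i, F, hF, rfl⟩

theorem Embeds.exists_inst_eq (hdb : ∀ A, A ∈ db ↔ ∃ i, ∃ F ∈ q.body, F.inst (θ i) = A)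
    (hq : q.SelfJoinFree) {μ : V → C} (hμ : q.Embeds db μ) {F : QAtom σ V C} (hF : F ∈ q.body) :
    ∃ i, F.inst μ = F.inst (θ i) := by
  obtain ⟨i, G, hG, h⟩ := (hdb _).1 (hμ F hF)
  have hrel : (G.inst (θ i)).rel = (F.inst μ).rel := by rw [h]
  obtain rfl := hq G hG F hF hrel
  exact ⟨i, h.symm⟩

/-- If the value at `u` identifies the copy `i`, then each atom containing `u` is mapped to its fact
in that copy. The copy thus propagates along paths. -/
theorem Embeds.eq_of_occurTogether (hdb : ∀ A, A ∈ db ↔ ∃ i, ∃ F ∈ q.body, F.inst (θ i) = A)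
    (hq : q.SelfJoinFree) {μ : V → C} (hμ : q.Embeds db μ) {u v : V} (h : q.OccurTogether u v)
    {i : ι} (hi : ∀ j, θ i u = θ j u → i = j) (hu : μ u = θ i u) : μ v = θ i v := by
  obtain ⟨F, hF, huF, hvF⟩ := h
  obtain ⟨j, hj⟩ := hμ.exists_inst_eq hdb hq hF
  obtain rfl := hi j (hu.symm.trans (RelAtom.inst_eq_inst_iff.1 hj u huF))
  exact RelAtom.inst_eq_inst_iff.1 hj v hvF

theorem exists_of_keyEqual (hdb : ∀ A, A ∈ db ↔ ∃ i, ∃ F ∈ q.body, F.inst (θ i) = A)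
    (hq : q.SelfJoinFree) {F : QAtom σ V C} (hF : F ∈ q.body) {i : ι} {B : DBFact σ C}
    (hB : B ∈ db) (h : (F.inst (θ i)).KeyEqual B) :
    ∃ j, B = F.inst (θ j) ∧ ∀ v ∈ F.key, θ i v = θ j v := by
  obtain ⟨j, G, hG, rfl⟩ := (hdb _).1 hB
  obtain rfl := hq.eq_of_keyEqual hF hG h
  exact ⟨j, rfl, RelAtom.inst_keyEqual_inst_iff.1 h⟩

theorem inst_mem_repair (hdb : ∀ A, A ∈ db ↔ ∃ i, ∃ F ∈ q.body, F.inst (θ i) = A)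
    (hq : q.SelfJoinFree) {F : QAtom σ V C} (hF : F ∈ q.body) {i : ι}
    (h : ∀ j, (∀ v ∈ F.key, θ i v = θ j v) → ∀ v ∈ F.vars, θ i v = θ j v) {r : Database σ C}
    (hr : db.IsRepair r) : F.inst (θ i) ∈ r := by
  refine hr.mem_of_forall (embeds_of_mem_iff hdb i F hF) fun B hB hFB => ?_
  obtain ⟨j, rfl, hj⟩ := exists_of_keyEqual hdb hq hF hB hFB
  exact RelAtom.inst_eq_inst_iff.2 (h j hj)

end Family

theorem ite_eq_ite_iff_of_injective {ι : Type*} {e : ι → C} (he : e.Injective) (a : C) {p : Prop}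
    [Decidable p] {i j : ι} : ((if p then a else e i) = if p then a else e j) ↔ i = j ∨ p := by
  by_cases hp : p <;> simp [hp, he.eq_iff]

-- Two copies agree exactly on what `free` and `x` determine. No two facts conflict, so every repair
-- has both full answers, while the database has just one tuple on `x`.
open Classical in
theorem ParsimoniousCounts.closure [Infinite C] (hq : q.SelfJoinFree) {x : Set V}
    (hx : x ⊆ q.bound) (h : q.ParsimoniousCounts x) :
    ∀ v ∈ q.vars, AtomClosure q.body (q.free ∪ x) v := by
  intro v hv
  by_contra hcl
  let e : Bool ↪ C := (Encodable.encode' Bool).trans (Infinite.natEmbedding C)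
  let Z : Set V := {v | AtomClosure q.body (q.free ∪ x) v}
  let θ : Bool → V → C := fun i v => if v ∈ Z then e true else e i
  have hθ : ∀ i j v, θ i v = θ j v ↔ i = j ∨ v ∈ Z :=
    fun i j v => ite_eq_ite_iff_of_injective e.injective _
  obtain ⟨db, hdb⟩ := q.exists_database θ
  have hmem : ∀ r, db.IsRepair r → ∀ i, q.Embeds r (θ i) := by
    intro r hr i F hF
    refine inst_mem_repair hdb hq hF (fun j hj v hv => (hθ i j v).2 ?_) hr
    by_cases hij : i = j
    · exact .inl hij
    · exact .inr (AtomClosure.step hF (fun u hu => ((hθ i j u).1 (hj u hu)).resolve_left hij) hv)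
  obtain ⟨-, r, hr, hcount⟩ := h db (θ true) fun r hr => ⟨_, hmem r hr true, fun _ _ => rfl⟩
  have hle : (q.answerSet x db (θ true)).ncard ≤ 1 := by
    refine Set.ncard_le_one (finite_answerSet (hx.trans Set.sdiff_subset) _ _) |>.2 ?_
    have key : ∀ d ∈ q.answerSet x db (θ true), d = fun v : x => θ true v := by
      rintro _ ⟨μ, ⟨hμ, -⟩, rfl⟩
      funext w
      obtain ⟨F, hF, hw⟩ := (hx w.2).1
      obtain ⟨i, hi⟩ := hμ.exists_inst_eq hdb hq hF
      refine (RelAtom.inst_eq_inst_iff.1 hi w hw).trans ((hθ i true w).2 (.inr ?_))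
      exact .base (.inr w.2)
    intro d hd d' hd'
    rw [key d hd, key d' hd']
  rw [← hcount, Set.ncard_le_one (finite_answerSet (x := q.bound) Set.sdiff_subset _ _)] at hle
  have hmem' : ∀ i, (fun w : q.bound => θ i w) ∈ q.answerSet q.bound r (θ true) := fun i =>
    ⟨θ i, ⟨hmem r hr i, fun w hw => (hθ i true w).2 (.inr (.base (.inl hw)))⟩, rfl⟩
  have heq := congrFun (hle _ (hmem' true) _ (hmem' false)) ⟨v, hv, fun hf => hcl (.base (.inl hf))⟩
  exact ((hθ _ _ _).1 heq).elim (by simp) hcl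

-- Two copies agree exactly on what `free` and `key R` determine without `R`. Only `R`-facts can
-- conflict, so the query is certain. In a repair containing copy `i`, the choice of the `R`-fact
-- propagates along the attack witness and forces the value of copy `i` at `v`; no value of `v`
-- works for both copies.
open Classical in
theorem ParsimoniousCounts.not_attacksVar [Infinite C] (hq : q.SelfJoinFree) {x : Set V}
    (h : q.ParsimoniousCounts x) {R : QAtom σ V C} (hR : R ∈ q.body) {v : V} (hv : v ∈ x) :
    ¬ q.AttacksVar R v := by
  intro hatt
  let e : Bool ↪ C := (Encodable.encode' Bool).trans (Infinite.natEmbedding C)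
  let Z : Set V := {v | AtomClosure (q.body \ {R}) (q.free ∪ R.key) v}
  let θ : Bool → V → C := fun i v => if v ∈ Z then e true else e i
  have hθ : ∀ i j v, θ i v = θ j v ↔ i = j ∨ v ∈ Z :=
    fun i j v => ite_eq_ite_iff_of_injective e.injective _
  obtain ⟨db, hdb⟩ := q.exists_database θ
  have hkey : ∀ i j, ∀ v ∈ R.key, θ i v = θ j v :=
    fun i j v hv => (hθ i j v).2 (.inr (.base (.inr hv)))
  have hfree : ∀ i j, ∀ v ∈ q.free, θ i v = θ j v :=
    fun i j v hv => (hθ i j v).2 (.inr (.base (.inl hv)))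
  have hcertain : q.Certain db (θ true) := by
    intro r hr
    obtain ⟨B, hB, hRB⟩ := hr.exists_keyEqual (embeds_of_mem_iff hdb true R hR)
    obtain ⟨i, rfl, -⟩ := exists_of_keyEqual hdb hq hR (hr.subset hB) hRB
    refine ⟨θ i, fun F hF => ?_, hfree i true⟩
    by_cases hFR : F = R
    · exact hFR ▸ hB
    · refine inst_mem_repair hdb hq hF (fun j hj v hv => (hθ i j v).2 ?_) hr
      by_cases hij : i = j
      · exact .inl hij
      · exact .inr (AtomClosure.step (F := F) ⟨hF, hFR⟩
          (fun u hu => ((hθ i j u).1 (hj u hu)).resolve_left hij) hv)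
  obtain ⟨⟨d, hd⟩, -⟩ := h db (θ true) hcertain
  have hval : ∀ i, d ⟨v, hv⟩ = θ i v := by
    intro i
    obtain ⟨r, hr, hθr⟩ := (embeds_of_mem_iff hdb i).exists_repair hq
    obtain ⟨μ, ⟨hμ, -⟩, rfl⟩ := hd r hr
    have hμdb := hμ.mono hr.subset
    have hRμ : R.inst μ = R.inst (θ i) := by
      obtain ⟨j, hj⟩ := hμdb.exists_inst_eq hdb hq hR
      refine hr.consistent _ (hμ R hR) _ (hθr R hR) ?_
      rw [hj]
      exact RelAtom.inst_keyEqual_inst_iff.2 (hkey j i)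
    have key : ∀ w, q.Reach R (q.keyClosure R) w → μ w = θ i w := by
      intro w hw
      induction hw with
      | base h1 _ _ => exact RelAtom.inst_eq_inst_iff.1 hRμ _ h1.1
      | @step a b h1 h2 h3 h4 ih =>
        refine hμdb.eq_of_occurTogether hdb hq h2 (fun j hj => ?_) ih
        exact ((hθ i j a).1 hj).resolve_right (attacksVar_iff.2 h1).not_closure
    exact key v (attacksVar_iff.1 hatt)
  exact (((hθ _ _ _).1 ((hval true).symm.trans (hval false))).elim (by simp) hatt.not_closure)

/-- Let `S` be the atoms on cycles. Each has a key variable attacked by its predecessor on a cycle,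
again in `S`, and a derivation of that variable must use the predecessor. So no atom of `S` can be
the first one used, and the keys in `S` would not be derivable. -/
theorem attackAcyclic_of_closure {x : Set V}
    (hK : ∀ v ∈ q.vars, AtomClosure q.body (q.free ∪ x) v)
    (hx : ∀ v ∈ x, ∀ R ∈ q.body, ¬ q.AttacksVar R v) : q.AttackAcyclic := by
  intro F hF
  have hZ : ∀ R ∈ q.body, ∀ z ∈ q.free ∪ x, ¬ q.AttacksVar R z := by
    rintro R hR z (hz | hz)
    · exact not_attacksVar_free hz
    · exact hx z hz R hR
  let S : Set (QAtom σ V C) :=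
    {G | ∃ h : G ∈ q.body, Relation.TransGen q.Attacks ⟨G, h⟩ ⟨G, h⟩}
  have hS : ∀ G ∈ S, ∃ k ∈ G.key, ¬ AtomClosure (q.body \ S) (q.free ∪ x) k := by
    rintro G ⟨hG, hGG⟩
    obtain ⟨E, hGE, hEG⟩ := Relation.TransGen.tail'_iff.1 hGG
    obtain ⟨hne, v, hv, hEv⟩ := hEG
    obtain ⟨k, hk, hEk⟩ := hEv.exists_key hG (fun h => hne (Subtype.ext h)) hv
    refine ⟨k, hk, fun hc => ?_⟩
    exact (hEk.mem_of_closure Set.sdiff_subset hc (hZ E E.2)).1.2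
      ⟨E.2, .head' ⟨hne, v, hv, hEv⟩ hGE⟩
  have hall : ∀ v, AtomClosure q.body (q.free ∪ x) v →
      AtomClosure (q.body \ S) (q.free ∪ x) v := by
    intro v hv
    induction hv with
    | base h => exact .base h
    | @step v E hE _ hv ih =>
      refine .step (F := E) ⟨hE, fun hES => ?_⟩ ih hv
      obtain ⟨k, hk, hk'⟩ := hS E hES
      exact hk' (ih k hk)
  obtain ⟨k, hk, hk'⟩ := hS F ⟨F.2, hF⟩
  exact hk' (hall k (hK k ⟨F, F.2, RelAtom.key_subset_vars _ hk⟩))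

/-- Trace a derivation of an attacked variable back until it leaves the variables attacked by `F`.
The variables met there adjoin attacked ones, hence are in the key closure of `F`, so the derivation
can start from `key F` instead. -/
theorem not_strongAttacks_of_closure {x : Set V}
    (hK : ∀ v ∈ q.vars, AtomClosure q.body (q.free ∪ x) v)
    (hx : ∀ v ∈ x, ∀ R ∈ q.body, ¬ q.AttacksVar R v) (F G : q.body) : ¬ q.StrongAttacks F G := by
  rintro ⟨⟨hne, y, hy, hFy⟩, hstrong⟩
  rw [fdImplies_fdSet_iff] at hstrong
  have hadj : ∀ u v, q.AttacksVar F u → q.OccurTogether u v → ¬ q.AttacksVar F v →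
      AtomClosure q.body (q.free ∪ (F : QAtom σ V C).key) v := fun u v hu huv hv =>
    ((hu.adj huv).resolve_left hv).mono Set.sdiff_subset subset_rfl
  have key : ∀ w, AtomClosure q.body (q.free ∪ x) w → q.AttacksVar F w →
      AtomClosure q.body (q.free ∪ (F : QAtom σ V C).key) w := by
    intro w hw
    induction hw with
    | base h =>
      exact fun ha => (h.elim (fun h => not_attacksVar_free h ha) fun h => hx _ h F F.2 ha).elim
    | @step v E hE _ hv ih =>
      intro ha
      refine .step hE (fun u hu => ?_) hv
      by_cases hu' : q.AttacksVar F u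
      · exact ih u hu hu'
      · exact hadj v u ha ⟨E, hE, hv, E.key_subset_vars hu⟩ hu'
  refine hstrong fun k hk => ?_
  have hkG := RelAtom.key_subset_vars _ hk
  by_cases hk' : q.AttacksVar F k
  · exact key k (hK k ⟨G, G.2, hkG⟩) hk'
  · exact hadj y k hFy ⟨G, G.2, hy, hkG⟩ hk'

theorem sourceCondition_of_closure {x : Set V} (hac : q.AttackAcyclic)
    (hK : ∀ v ∈ q.vars, AtomClosure q.body (q.free ∪ x) v) : q.SourceCondition x := by
  intro M
  induction M using SimpleGraph.ConnectedComponent.ind with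
  | _ H =>
    obtain ⟨U, hU, hUH⟩ := hac.exists_unattacked H
    refine ⟨U, ?_, hU, (q.fdImplies_fdSet_iff _ _).2 fun k hk =>
      hK k ⟨U, U.2, RelAtom.key_subset_vars _ hk⟩⟩
    rw [SimpleGraph.ConnectedComponent.mem_supp_iff, SimpleGraph.ConnectedComponent.eq]
    rcases hUH with rfl | h
    · exact .rfl
    · refine SimpleGraph.Adj.reachable ?_
      rw [weakAttackGraph, SimpleGraph.fromRel_adj]
      exact ⟨h.1, .inl h⟩

/-- Along a path without frozen variables that ends in an unattacked variable, no variable is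
derivable from the free ones. -/
theorem not_closure_of_walk {u v : q.bound} (p : q.queryGraph.Walk u v)
    (hv : ∀ R ∈ q.body, ¬ q.AttacksVar R v) (hp : ∀ z ∈ p.support, (z : V) ∉ q.frozen) :
    ∀ z ∈ p.support, ¬ AtomClosure q.body q.free z := by
  induction p with
  | @nil u =>
    intro z hz hcl
    obtain rfl : z = u := by simpa using hz
    exact hp z hz (mem_frozen_of_not_attacksVar z.2.1 hcl hv)
  | @cons u w v hadj p ih =>
    have hp' : ∀ z ∈ p.support, (z : V) ∉ q.frozen := fun z hz => hp z (by simp [hz])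
    have ih' := ih hv hp'
    intro z hz
    rw [SimpleGraph.Walk.support_cons, List.mem_cons] at hz
    rcases hz with rfl | hz
    · intro hcl
      -- As `key E` is derivable from the free variables, so is its key closure. By induction the
      -- rest of the path avoids it, so the attack of `E` would travel to the unattacked end `v`.
      obtain ⟨E, hE, hEu, hkey⟩ := exists_attacksVar_of_notMem_frozen z.2.1 hcl (hp z (by simp))
      have hsub : ∀ y, AtomClosure (q.body \ {E}) (q.free ∪ E.key) y →
          AtomClosure q.body q.free y := fun y hy => hy.trans Set.sdiff_subset (by
        rintro a (ha | ha)
        · exact .base ha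
        · exact hkey a ha)
      have hwalk : ∀ {a b : q.bound} (p : q.queryGraph.Walk a b), q.AttacksVar E a →
          (∀ z ∈ p.support, ¬ AtomClosure q.body q.free z) → q.AttacksVar E b := by
        intro a b p
        induction p with
        | nil => exact fun h _ => h
        | cons h p ihp =>
          intro ha hs
          refine ihp ((ha.adj h.2).resolve_right fun hc => hs _ ?_ (hsub _ hc)) fun z hz =>
            hs z (by simp [hz])
          simp
      refine hv E hE (hwalk p ((hEu.adj hadj.2).resolve_right fun hc => ?_) ih')
      exact ih' w p.start_mem_support (hsub _ hc)
    · exact ih' z hz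

open Classical in
theorem ParsimoniousCounts.separationCondition [Infinite C] (hq : q.SelfJoinFree) {x : Set V}
    (hx : x ⊆ q.bound) (h : q.ParsimoniousCounts x) : q.SeparationCondition x := by
  intro R hR u v hu hv p
  by_contra! hp
  have hcl := not_closure_of_walk p (fun R hR => h.not_attacksVar hq hR hv)
    fun z hz hf => hp z hz (.inr hf)
  let e : Fin 3 ↪ C := (Encodable.encode' (Fin 3)).trans (Infinite.natEmbedding C)
  let Z : Set V := {v | AtomClosure q.body q.free v}
  -- Copies 1 and 2 agree on `key R` and differ along the path. Copy 0 meets the others only in `Z`,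
  -- so its facts have no conflict and it makes the query certain.
  let θ : Fin 3 → V → C := fun i v =>
    if v ∈ Z then e 0 else if v ∈ R.key ∧ i = 2 then e 1 else e i
  have hZ : ∀ i j, ∀ v ∈ Z, θ i v = θ j v := fun i j v hv => by simp [θ, hv]
  have hzero : ∀ j v, θ 0 v = θ j v → j = 0 ∨ v ∈ Z := by
    intro j v hj
    by_contra! hc
    by_cases hk : v ∈ R.key ∧ j = 2 <;> simp [θ, hc.2, hk, e.injective.eq_iff] at hj
    exact hc.1 hj.symm
  have hpath : ∀ i j v, v ∉ Z → v ∉ R.key → θ i v = θ j v → i = j := by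
    intro i j v h1 h2 hij
    simpa [θ, h1, h2, e.injective.eq_iff] using hij
  have hkey : ∀ v ∈ R.key, θ 1 v = θ 2 v := by
    intro v hv
    simp [θ, hv]
  obtain ⟨db, hdb⟩ := q.exists_database θ
  have hcertain : q.Certain db (θ 0) := by
    refine fun r hr => ⟨θ 0, fun F hF => inst_mem_repair hdb hq hF (fun j hj v hv => ?_) hr,
      fun _ _ => rfl⟩
    by_cases hj0 : j = 0
    · rw [hj0]
    · exact hZ 0 j v (AtomClosure.step hF (fun k hk => (hzero j k (hj k hk)).resolve_left hj0) hv)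
  obtain ⟨-, r, hr, hcount⟩ := h db (θ 0) hcertain
  rw [ncard_answerSet_bound hx (h.closure hq hx) hr.consistent] at hcount
  -- The repair with the greatest count keeps all answers on `x`. Following the path back from `v`
  -- to `u`, it must contain the `R`-facts of copies 1 and 2, which are key-equal but differ at `u`.
  have hsets : q.answerSet x r (θ 0) = q.answerSet x db (θ 0) :=
    Set.eq_of_subset_of_ncard_le (answerSet_mono hr.subset _) hcount.ge
      (finite_answerSet (hx.trans Set.sdiff_subset) _ _)
  have hback : ∀ (i : Fin 3) (μ : V → C), q.Embeds db μ → ∀ {a b : q.bound}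
      (p : q.queryGraph.Walk a b), (∀ z ∈ p.support, (z : V) ∉ Z ∧ (z : V) ∉ R.key) →
      μ b = θ i b → μ a = θ i a := by
    intro i μ hμ a b p
    induction p with
    | nil => exact fun _ h => h
    | @cons a w b hadj p ih =>
      intro hs hb
      have hw := hs w (by simp)
      exact hμ.eq_of_occurTogether hdb hq (OccurTogether.symm hadj.2)
        (fun j hj => hpath i j w hw.1 hw.2 hj) (ih (fun z hz => hs z (by simp [hz])) hb)
  have hs : ∀ z ∈ p.support, (z : V) ∉ Z ∧ (z : V) ∉ R.key :=
    fun z hz => ⟨hcl z hz, fun hk => hp z hz (.inl hk)⟩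
  have hus := hs u p.start_mem_support
  have hmem : ∀ i, R.inst (θ i) ∈ r := by
    intro i
    have : (fun w : x => θ i w) ∈ q.answerSet x r (θ 0) := by
      rw [hsets]
      exact ⟨θ i, ⟨embeds_of_mem_iff hdb i, fun w hw => hZ i 0 w (.base hw)⟩, rfl⟩
    obtain ⟨μ, ⟨hμ, -⟩, hμx⟩ := this
    have hμdb := hμ.mono hr.subset
    have hμu : μ u = θ i u := hback i μ hμdb p hs (congrFun hμx ⟨v, hv⟩)
    obtain ⟨j, hj⟩ := hμdb.exists_inst_eq hdb hq hR
    have hij : i = j := hpath i j u hus.1 hus.2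
      (hμu.symm.trans (RelAtom.inst_eq_inst_iff.1 hj u hu.1))
    rw [hij, ← hj]
    exact hμ R hR
  have heq := hr.consistent _ (hmem 1) _ (hmem 2) (RelAtom.inst_keyEqual_inst_iff.2 hkey)
  have := hpath 1 2 u hus.1 hus.2 (RelAtom.inst_eq_inst_iff.1 heq u hu.1)
  simp at this

theorem AdmitsParsimoniousCounting.inCparsimony [Infinite C] (hq : q.SelfJoinFree)
    (h : q.AdmitsParsimoniousCounting) : q.InCparsimony := by
  obtain ⟨x, hx, h⟩ := h
  have hcounts := h.parsimoniousCounts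
  have hK := hcounts.closure hq hx
  have hatt : ∀ v ∈ x, ∀ R ∈ q.body, ¬ q.AttacksVar R v :=
    fun v hv R hR => hcounts.not_attacksVar hq hR hv
  have hac := attackAcyclic_of_closure hK hatt
  exact ⟨hac, not_strongAttacks_of_closure hK hatt, x, hx, sourceCondition_of_closure hac hK,
    hcounts.separationCondition hq hx⟩

end ConjQuery

theorem theorem2 {σ : Schema} {V C : Type*} [Infinite C] (q : ConjQuery σ V C)
    (hq : q.SelfJoinFree) :
    q.AdmitsParsimoniousCounting ↔ q.InCparsimony :=
  ⟨fun h => h.inCparsimony hq, fun h => h.admitsParsimoniousCounting hq⟩
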